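/- Let $k$ be a field and let $P$ be a simplicial poset, i.e. a finite poset with a least element $\hat 0$ such that every interval $[\hat 0,y]$ is a Boolean lattice. Let $x_1,\dots,x_n$ be the atoms of $P$, let $A=k[x_1,\dots,x_n]$, $\mathfrak m=(x_1,\dots,x_n)$ and, for a positive integer $\ell$, $\mathfrak m_\ell=(x_1^\ell,\dots,x_n^\ell)$. For $w,y\in P$ let $\mathcal M(w,y)$ be the set of minimal upper bounds of $w$ and $y$. The face ring of $P$ is $A_P=k[y : y\in P]/I_P$, where $I_P$ is generated by $\hat 0-1$, the products $wy$ with $\mathcal M(w,y)=\emptyset$, and the elements $wy-(w\wedge y)\sum_{z\in\mathcal M(w,y)}z$ with $\mathcal M(w,y)\neq\emptyset$. It is an $A$-module through $x_i\mapsto x_i$, and $A$ and $A_P$ are $\mathbb Z^n$-graded by $\deg y=\sum_{i:\,x_i\preceq y}\mathbf e_i$. For $\alpha\in\mathbb Z^n$ let $\mathrm{Ext}^i_A(A/\mathfrak m_\ell,A_P)_\alpha$ be the subspace of classes of cocycles that are homogeneous of degree $\alpha$ on a $\mathbb Z^n$-graded projective resolution of $A/\mathfrak m_\ell$ (and likewise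 for $A/\mathfrak m^t$), let $H^i_{\mathfrak m}(A_P)=\varinjlim_t\mathrm{Ext}^i_A(A/\mathfrak m^t,A_P)$, and let $H^i_{\mathfrak m}(A_P)_\alpha$ be the subspace spanned by the images of all $\mathrm{Ext}^i_A(A/\mathfrak m^t,A_P)_\alpha$. The canonical map $\mathrm{Ext}^i_A(A/\mathfrak m_\ell,A_P)\to H^i_{\mathfrak m}(A_P)$ is the composite $\mathrm{Ext}^i_A(A/\mathfrak m_\ell,A_P)\to\mathrm{Ext}^i_A(A/\mathfrak m^t,A_P)\to H^i_{\mathfrak m}(A_P)$ for any $t$ with $\mathfrak m^t\subseteq\mathfrak m_\ell$. If $\alpha\in\mathbb Z^n$ satisfies $1-\ell\le\alpha_i$ for all $i$, then for every $i\ge 0$ the canonical map restricts to a $k$-linear isomorphism $$\mathrm{Ext}^i_A(A/\mathfrak m_\ell,A_P)_\alpha\longrightarrow H^i_{\mathfrak m}(A_P)_\alpha .$$ -/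

import Mathlib

open CategoryTheory CategoryTheory.Limits Opposite MvPolynomial
open scoped ModuleCat

universe u v

noncomputable section

/-! ### Simplicial posets and their face rings -/

/-- A finite poset with least element `⊥` is a simplicial poset if every interval `[⊥, y]` is a
Boolean lattice (finiteness and the least element are carried by the type classes). -/
structure IsSimplicialPoset (P : Type v) [PartialOrder P] [OrderBot P] [Finite P] : Prop where
  boolean_Iic : ∀ y : P, ∃ (B : Type v) (_ : BooleanAlgebra B), Nonempty (Set.Iic y ≃o B)

/-- The vertices of a poset with least element: its atoms. -/
abbrev PosetVertex (P : Type v) [PartialOrder P] [OrderBot P] : Type v := {x : P // IsAtom x}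

/-- The set of minimal upper bounds of `w` and `y`. -/
def minUpperBounds {P : Type v} [PartialOrder P] (w y : P) : Set P :=
  {z | Minimal (fun b => w ≤ b ∧ y ≤ b) z}

/-- The face ideal, in the polynomial ring whose variables are all elements of `P`. It is generated
by `w y` for `w, y` without upper bound, by `w y - (w ∧ y) ∑ z` (sum over the minimal
upper bounds `z` of `w, y`) for the other pairs, and by `⊥ - 1`. In a simplicial poset two elements
with an upper bound have a meet, and `g` below is that meet. -/
def faceIdeal (k : Type u) [Field k] (P : Type v) [PartialOrder P] [OrderBot P] :
    Ideal (MvPolynomial P k) :=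
  Ideal.span
    ({f | ∃ w y : P, minUpperBounds w y = ∅ ∧ f = X w * X y} ∪
     {f | ∃ w y g : P, (minUpperBounds w y).Nonempty ∧ IsGLB {w, y} g ∧
        f = X w * X y - X g * ∑ᶠ z ∈ minUpperBounds w y, X z} ∪
     {X ⊥ - 1})

/-- The face ring `A_P` of `P` over `k`. -/
def FaceRing (k : Type u) [Field k] (P : Type v) [PartialOrder P] [OrderBot P] : Type (max u v) :=
  MvPolynomial P k ⧸ faceIdeal k P

instance (k : Type u) [Field k] (P : Type v) [PartialOrder P] [OrderBot P] :
    CommRing (FaceRing k P) :=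
  inferInstanceAs (CommRing (MvPolynomial P k ⧸ faceIdeal k P))

/-- The quotient map from the polynomial ring on all elements of `P` to the face ring. -/
def faceRingMk (k : Type u) [Field k] (P : Type v) [PartialOrder P] [OrderBot P] :
    MvPolynomial P k →+* FaceRing k P :=
  Ideal.Quotient.mk (faceIdeal k P)

/-- The polynomial ring `A` whose variables are the vertices of `P`. -/
abbrev VertexRing (k : Type u) [Field k] (P : Type v) [PartialOrder P] [OrderBot P] :
    Type (max u v) :=
  MvPolynomial (PosetVertex P) k

/-- The face ring as an `A`-algebra, hence as an `A`-module: a variable of `A` acts through the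
corresponding vertex of `P`. -/
instance (k : Type u) [Field k] (P : Type v) [PartialOrder P] [OrderBot P] :
    Algebra (VertexRing k P) (FaceRing k P) :=
  ((faceRingMk k P).comp
    (rename (Subtype.val : PosetVertex P → P) : VertexRing k P →ₐ[k] MvPolynomial P k)).toAlgebra

open Classical in
/-- The degree in `ℤ^V` of the variable `y`: the indicator vector of the support of `y`, that is, of
the set of vertices below `y`. -/
def supportDegree {P : Type v} [PartialOrder P] [OrderBot P] (y : P) : PosetVertex P → ℤ :=
  fun x => if x.1 ≤ y then 1 else 0

/-- The piece of degree `α` of the face ring: the image of the polynomials, in the elements of `P`,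
all of whose monomials have degree `α`. -/
def faceRingPiece (k : Type u) [Field k] (P : Type v) [PartialOrder P] [OrderBot P]
    (α : PosetVertex P → ℤ) : AddSubgroup (FaceRing k P) :=
  (weightedHomogeneousSubmodule k supportDegree α).toAddSubgroup.map (faceRingMk k P).toAddMonoidHom

/-! ### Fine-graded `Ext` and local cohomology over a polynomial ring -/

section Graded

variable {k : Type u} [Field k] {σ : Type v}

open Classical in
/-- The piece of degree `α` of `k[x_s : s ∈ σ]` in the grading with `deg x_s = e_s`. -/
def polyPiece (k : Type u) [Field k] {σ : Type v} (α : σ → ℤ) : AddSubgroup (MvPolynomial σ k) :=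
  (weightedHomogeneousSubmodule k (fun s : σ => (Pi.single s 1 : σ → ℤ)) α).toAddSubgroup

/-- The pieces of `A / J`, for an ideal `J` generated by monomials. -/
def quotientPiece (J : Ideal (MvPolynomial σ k)) (α : σ → ℤ) :
    AddSubgroup (MvPolynomial σ k ⧸ J) :=
  (polyPiece k α).map (Ideal.Quotient.mk J).toAddMonoidHom

open Classical in
/-- A graded projective resolution of an `A`-module `N` whose graded pieces are `𝒩 α`: a projective
resolution with a `ℤ^σ`-grading on each term making it a graded `A`-module, such that the
differentials and the augmentation preserve degrees. -/
structure GradedResolution (N : ModuleCat.{max u v} (MvPolynomial σ k))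
    (𝒩 : (σ → ℤ) → AddSubgroup N) where
  res : ProjectiveResolution N
  piece : ∀ t : ℕ, (σ → ℤ) → AddSubgroup (res.complex.X t)
  isInternal : ∀ t, DirectSum.IsInternal (piece t)
  smul_mem : ∀ (t : ℕ) (β γ : σ → ℤ) (a : MvPolynomial σ k) (x : res.complex.X t),
    a ∈ polyPiece k β → x ∈ piece t γ → a • x ∈ piece t (β + γ)
  d_mem : ∀ (t : ℕ) (β : σ → ℤ) (x : res.complex.X (t + 1)),
    x ∈ piece (t + 1) β → (res.complex.d (t + 1) t).hom x ∈ piece t β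
  augmentation_mem : ∀ (β : σ → ℤ) (x : res.complex.X 0),
    x ∈ piece 0 β → (res.π.f 0 ≫ (HomologicalComplex.singleObjXSelf _ 0 N).hom).hom x ∈ 𝒩 β

/-- `Ext^i_A(N, M)`. -/
abbrev ExtMod (i : ℕ) (N M : ModuleCat.{max u v} (MvPolynomial σ k)) :
    ModuleCat.{max u v} (MvPolynomial σ k) :=
  ((Ext (MvPolynomial σ k) (ModuleCat.{max u v} (MvPolynomial σ k)) i).obj (op N)).obj M

/-- The piece `Ext^i_A(N, M)_α` for graded modules `N` and `M`: it consists of the classes of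
those cocycles `f : F_i → M`, for a graded projective resolution `F` of `N`, that are homogeneous of
degree `α`, i.e. map the piece of degree `β` into the piece of degree `α + β` for all `β`. -/
def extPiece (i : ℕ) (N M : ModuleCat.{max u v} (MvPolynomial σ k))
    (𝒩 : (σ → ℤ) → AddSubgroup N) (ℳ : (σ → ℤ) → AddSubgroup M) (α : σ → ℤ) :
    Submodule k (ExtMod i N M) :=
  Submodule.span k
    {e | ∃ (F : GradedResolution N 𝒩)
        (z : (F.res.complex.linearYonedaObj (MvPolynomial σ k) M).cycles i)
        (f : F.res.complex.X i ⟶ M),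
        ((F.res.complex.linearYonedaObj (MvPolynomial σ k) M).iCycles i).hom z = f ∧
        (∀ (β : σ → ℤ) (x : F.res.complex.X i), x ∈ F.piece i β → f.hom x ∈ ℳ (α + β)) ∧
        e = (F.res.isoExt i M).inv.hom
          (((F.res.complex.linearYonedaObj (MvPolynomial σ k) M).homologyπ i).hom z)}

/-- The structure map `Ext^i_A(A/I^t, M) → H^i_I(M)` of local cohomology as a direct limit. -/
def toLocalCohomology (I : Ideal (MvPolynomial σ k)) (i t : ℕ)
    (M : ModuleCat.{max u v} (MvPolynomial σ k)) :
    ExtMod i (ModuleCat.of _ (MvPolynomial σ k ⧸ I ^ t)) M ⟶ (localCohomology I i).obj M :=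
  (colimit.ι (localCohomology.diagram (localCohomology.idealPowersDiagram I) i)
    (op (op t))).app M

/-- The piece `H^i_I(M)_α` for a monomial ideal `I` and a graded module `M`: the direct limit (as a
subspace of `H^i_I(M)`) of the pieces `Ext^i_A(A/I^t, M)_α`. -/
def localCohomologyPiece (I : Ideal (MvPolynomial σ k)) (i : ℕ)
    (M : ModuleCat.{max u v} (MvPolynomial σ k))
    (ℳ : (σ → ℤ) → AddSubgroup M) (α : σ → ℤ) :
    Submodule k ((localCohomology I i).obj M) :=
  ⨆ t : ℕ, (extPiece i (ModuleCat.of _ (MvPolynomial σ k ⧸ I ^ t)) M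
    (quotientPiece (I ^ t)) ℳ α).map ((toLocalCohomology I i t M).hom.restrictScalars k)

/-- The canonical map `Ext^i_A(A/J, M) → H^i_I(M)`, for an ideal `J` containing a power `I ^ t`:
the map `Ext^i_A(A/J, M) → Ext^i_A(A/I^t, M)` induced by the projection `A/I^t → A/J`, followed by
the structure map of the direct limit. It does not depend on `t`. -/
def canonicalMap (I J : Ideal (MvPolynomial σ k)) (i t : ℕ) (h : I ^ t ≤ J)
    (M : ModuleCat.{max u v} (MvPolynomial σ k)) :
    ExtMod i (ModuleCat.of _ (MvPolynomial σ k ⧸ J)) M ⟶ (localCohomology I i).obj M :=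
  ((Ext (MvPolynomial σ k) (ModuleCat.{max u v} (MvPolynomial σ k)) i).map
    (ModuleCat.ofHom (Ideal.Quotient.factorₐ (MvPolynomial σ k) h).toLinearMap).op).app M ≫
    toLocalCohomology I i t M

/-- The irrelevant ideal `(x_s : s ∈ σ)`. -/
def irrelevantIdeal (k : Type u) [Field k] (σ : Type v) : Ideal (MvPolynomial σ k) :=
  Ideal.span (Set.range fun s => X s)

/-- The ideal `(x_s ^ ℓ : s ∈ σ)`. -/
def powerIdeal (k : Type u) [Field k] (σ : Type v) (ℓ : ℕ) : Ideal (MvPolynomial σ k) :=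
  Ideal.span (Set.range fun s => X s ^ ℓ)

theorem exists_irrelevantIdeal_pow_le [Finite σ] (ℓ : ℕ) :
    ∃ t, irrelevantIdeal k σ ^ t ≤ powerIdeal k σ ℓ := by
  refine Ideal.exists_pow_le_of_le_radical_of_fg ?_ ?_
  · rw [irrelevantIdeal, Ideal.span_le]
    rintro _ ⟨s, rfl⟩
    exact ⟨ℓ, Ideal.subset_span ⟨s, rfl⟩⟩
  · exact Submodule.fg_span (Set.finite_range _)

open Classical in
/-- The canonical map `Ext^i_A(A/m_ℓ, M) → H^i_m(M)`, where `m` is the irrelevant ideal and `m_ℓ` is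
generated by the `ℓ`-th powers of the variables. -/
def canonicalMapPower [Finite σ] (ℓ i : ℕ) (M : ModuleCat.{max u v} (MvPolynomial σ k)) :
    ExtMod i (ModuleCat.of _ (MvPolynomial σ k ⧸ powerIdeal k σ ℓ)) M ⟶
      (localCohomology (irrelevantIdeal k σ) i).obj M :=
  canonicalMap (irrelevantIdeal k σ) (powerIdeal k σ ℓ) i
    (Nat.find (exists_irrelevantIdeal_pow_le (k := k) (σ := σ) ℓ))
    (Nat.find_spec (exists_irrelevantIdeal_pow_le (k := k) (σ := σ) ℓ)) M

end Graded

end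

/-! The face ring $A_P$ is a squarefree module: if $\gamma_s\ge 1$ on the support of $d$,
multiplication by $x^d$ is a bijection from the piece of degree $\gamma$ onto the piece of degree
$\gamma+d$ (`isSquarefree_faceRing`). Everything else is formal.

Resolve $A/\mathfrak m_\ell$ by the Taylor complex of $x_1^\ell,\dots,x_n^\ell$, with one generator
of degree $\ell\mathbf 1_S$ for each set $S$ of variables. A cochain of degree $\alpha$ is a choice
of elements of $(A_P)_{\alpha+\ell\mathbf 1_S}$. For $\ell\le\ell'$ the projection $A/\mathfrak
m_{\ell'}\to A/\mathfrak m_\ell$ lifts to the chain map sending the generator $S$ to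
$x^{(\ell'-\ell)\mathbf 1_S}$ times the generator $S$. On cochains of degree $\alpha$ it is
therefore multiplication $(A_P)_{\alpha+\ell\mathbf 1_S}\to(A_P)_{\alpha+\ell'\mathbf 1_S}$, which
is bijective because $\alpha_s+\ell\ge 1$ for $s\in S$. So the pieces of degree $\alpha$ of
$\mathrm{Ext}$ do not change from $\ell$ to $\ell'$ (`eq_zero_of_ext_map_eq_zero`,
`exists_ext_map_eq`), and since the ideals $\mathfrak m_{\ell'}$ are cofinal with the powers of
$\mathfrak m$, the claim follows in the limit (`exists_equiv_localCohomologyPiece`).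

Two points need work. `extPiece` ranges over all graded resolutions, and `mem_extPiece_iff` reduces
it to the Taylor resolution by degree-preserving lifts. Squarefreeness rests on a basis of $A_P$:
the monomials $x^{e-\deg y}y$ for which $y$ has exactly the support of $e$. They span by
straightening with the face relations (`isStandardSum_monomial`), and restriction to the faces $w\in
P$ shows that they are independent (`IsStandardSum.eq_zero_of_faceEval`). -/

noncomputable section

/-! ### Functoriality of Ext computed on projective resolutions -/

section ExtNaturality

universe w₁ w₂ w₃
variable {R : Type w₁} [Ring R] {C : Type w₂} [Category.{w₃} C] [Abelian C] [Linear R C]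

/-- Precomposition with a chain map, as a map of cochain complexes of morphisms to `M`. -/
def linearYonedaObjMap {K L : ChainComplex C ℕ} (g : K ⟶ L) (M : C) :
    L.linearYonedaObj R M ⟶ K.linearYonedaObj R M :=
  (HomologicalComplex.unopFunctor (ModuleCat R) (ComplexShape.down ℕ)).map
    ((((linearYoneda R C).obj M).rightOp.mapHomologicalComplex _).map g).op

variable [EnoughProjectives C]

/-- `Ext` is built from a left derived functor into an opposite category, so this is the naturality
of `isoLeftDerivedObj` with arrows reversed. It allows any lift `g` of `φ` to compute the induced
map. -/
theorem Ext_map_app_eq {X Y : C} (φ : X ⟶ Y) (P : ProjectiveResolution X)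
    (Q : ProjectiveResolution Y) (g : P.complex ⟶ Q.complex)
    (hg : g.f 0 ≫ Q.π.f 0 = P.π.f 0 ≫ φ) (M : C) (i : ℕ) :
    (Q.isoExt i M).inv ≫ ((Ext R C i).map φ.op).app M =
      HomologicalComplex.homologyMap (linearYonedaObjMap g M) i ≫ (P.isoExt i M).inv := by
  have h := P.isoLeftDerivedObj_hom_naturality φ Q g hg ((linearYoneda R C).obj M).rightOp i
  have h2 := HomologicalComplex.homologyOp_hom_naturality (linearYonedaObjMap (R := R) g M) i
  have h3 : HomologicalComplex.homologyMap (linearYonedaObjMap (R := R) g M) i ≫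
      (HomologicalComplex.homologyUnop
        ((((linearYoneda R C).obj M).rightOp.mapHomologicalComplex _).obj P.complex) i).hom =
      (HomologicalComplex.homologyUnop
        ((((linearYoneda R C).obj M).rightOp.mapHomologicalComplex _).obj Q.complex) i).hom ≫
      (HomologicalComplex.homologyMap
        ((((linearYoneda R C).obj M).rightOp.mapHomologicalComplex _).map g) i).unop :=
    (congrArg Quiver.Hom.unop h2).symm
  have h1 := congrArg Quiver.Hom.unop h
  change ((HomologicalComplex.homologyUnop _ i).hom ≫ (Q.isoLeftDerivedObj _ i).hom.unop) ≫
    ((((linearYoneda R C).obj M).rightOp.leftDerived i).map φ).unop =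
    _ ≫ ((HomologicalComplex.homologyUnop _ i).hom ≫ (P.isoLeftDerivedObj _ i).hom.unop)
  refine (Category.assoc _ _ _).trans ((congrArg _ h1).trans ?_)
  exact (Category.assoc _ _ _).symm.trans
    ((congrArg (· ≫ (P.isoLeftDerivedObj _ i).hom.unop) h3.symm).trans (Category.assoc _ _ _))

end ExtNaturality

/-! ### Ext classes represented by cocycles -/

section Cocycles

universe w
variable {A : Type w} [CommRing A] {N N' M : ModuleCat.{w} A} {i : ℕ}

/-- The class `e` in `Ext^i(N, M)` is represented by the cocycle `f` on the projective
resolution `F` of `N`. -/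
def RepresentsExt (F : ProjectiveResolution N) (f : F.complex.X i ⟶ M)
    (e : ((Ext A (ModuleCat.{w} A) i).obj (op N)).obj M) : Prop :=
  ∃ z : (F.complex.linearYonedaObj A M).cycles i,
    ((F.complex.linearYonedaObj A M).iCycles i).hom z = f ∧
    e = (F.isoExt i M).inv.hom (((F.complex.linearYonedaObj A M).homologyπ i).hom z)

namespace RepresentsExt

variable {F : ProjectiveResolution N} {f f' : F.complex.X i ⟶ M}
  {e e' : ((Ext A (ModuleCat.{w} A) i).obj (op N)).obj M}

theorem add (h : RepresentsExt F f e) (h' : RepresentsExt F f' e') :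
    RepresentsExt F (f + f') (e + e') := by
  obtain ⟨z, rfl, rfl⟩ := h
  obtain ⟨z', rfl, rfl⟩ := h'
  exact ⟨z + z', map_add _ _ _, by simp only [map_add]⟩

theorem smul (a : A) (h : RepresentsExt F f e) : RepresentsExt F (a • f) (a • e) := by
  obtain ⟨z, rfl, rfl⟩ := h
  exact ⟨a • z, map_smul _ _ _, by simp only [map_smul]⟩

theorem zero : RepresentsExt F (0 : F.complex.X i ⟶ M) 0 :=
  ⟨0, map_zero _, by simp only [map_zero]⟩

theorem cocycle (h : RepresentsExt F f e) (j : ℕ) : F.complex.d j i ≫ f = 0 := by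
  obtain ⟨z, rfl, rfl⟩ := h
  have := (F.complex.linearYonedaObj A M).iCycles_d i j
  exact congr($(this).hom z)

theorem iCycles_injective :
    Function.Injective ((F.complex.linearYonedaObj A M).iCycles i).hom :=
  (ModuleCat.mono_iff_injective _).1 inferInstance

theorem unique (h : RepresentsExt F f e) (h' : RepresentsExt F f e') : e = e' := by
  obtain ⟨z, hz, rfl⟩ := h
  obtain ⟨z', hz', rfl⟩ := h'
  rw [iCycles_injective (hz.trans hz'.symm)]

theorem exists_of_cocycle (hf : F.complex.d (i + 1) i ≫ f = 0) :
    ∃ e, RepresentsExt F f e := by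
  let z := (F.complex.linearYonedaObj A M).cyclesMk (i := i) f (i + 1) (by simp) hf
  exact ⟨_, z, (F.complex.linearYonedaObj A M).i_cyclesMk (i := i) f (i + 1) (by simp) hf, rfl⟩

/-- For `i = 0` the predecessor `j` is `0` and `F.complex.d 0 0` is zero, so the criterion then
reads `f = 0`; no case distinction is needed. -/
theorem iff_coboundary {j : ℕ} (hj : (ComplexShape.up ℕ).prev i = j) :
    RepresentsExt F f 0 ↔ ∃ h : F.complex.X j ⟶ M, f = F.complex.d i j ≫ h := by
  subst hj
  have hex : ∀ z : (F.complex.linearYonedaObj A M).cycles i,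
      ((F.complex.linearYonedaObj A M).homologyπ i).hom z = 0 ↔
      ∃ h, ((F.complex.linearYonedaObj A M).toCycles ((ComplexShape.up ℕ).prev i) i).hom h = z := by
    intro z
    have := ShortComplex.exact_of_g_is_cokernel (ShortComplex.mk _ _
      ((F.complex.linearYonedaObj A M).toCycles_comp_homologyπ ((ComplexShape.up ℕ).prev i) i))
      ((F.complex.linearYonedaObj A M).homologyIsCokernel _ i rfl)
    rw [ShortComplex.ShortExact.moduleCat_exact_iff_function_exact] at this
    exact this z
  have hinj : Function.Injective (F.isoExt (R := A) i M).inv.hom :=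
    (ModuleCat.mono_iff_injective _).1 inferInstance
  constructor
  · rintro ⟨z, rfl, hz⟩
    obtain ⟨h, rfl⟩ := (hex z).1 (hinj (by rw [← hz, map_zero]))
    exact ⟨h, congr($((F.complex.linearYonedaObj A M).toCycles_i _ i).hom h)⟩
  · rintro ⟨h, rfl⟩
    refine ⟨((F.complex.linearYonedaObj A M).toCycles _ i).hom h,
      congr($((F.complex.linearYonedaObj A M).toCycles_i _ i).hom h), ?_⟩
    rw [(hex _).2 ⟨h, rfl⟩, map_zero]

theorem map (h : RepresentsExt F f e) (F' : ProjectiveResolution N') (φ : N' ⟶ N)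
    (g : F'.complex ⟶ F.complex) (hg : g.f 0 ≫ F.π.f 0 = F'.π.f 0 ≫ φ) :
    RepresentsExt F' (g.f i ≫ f)
      ((((Ext A (ModuleCat.{w} A) i).map φ.op).app M).hom e) := by
  obtain ⟨z, rfl, rfl⟩ := h
  refine ⟨(HomologicalComplex.cyclesMap (linearYonedaObjMap g M) i).hom z, ?_, ?_⟩
  · exact congr($(HomologicalComplex.cyclesMap_i (linearYonedaObjMap (R := A) g M) i).hom z)
  · have h1 := congr($(Ext_map_app_eq (R := A) φ F' F g hg M i).hom
      (((F.complex.linearYonedaObj A M).homologyπ i).hom z))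
    have h2 := congr($(HomologicalComplex.homologyπ_naturality
      (linearYonedaObjMap (R := A) g M) i).hom z)
    exact h1.trans (congrArg (F'.isoExt (R := A) i M).inv.hom h2)

end RepresentsExt

end Cocycles

/-! ### Internal gradings of abelian groups and their projections -/

section Gradings

universe w₁ w₂ w₃ w₄
variable {I : Type w₁} {X : Type w₂} [AddCommGroup X] {piece : I → AddSubgroup X}

open Classical in
/-- Pieces that span are independent if a family of homomorphisms to a graded group, compatible with
the degrees, detects the nonzero elements of each piece. -/
theorem isInternal_of_separating {W : Type w₃} {Y : Type w₄} [AddCommGroup Y] (φ : W → X →+ Y)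
    (π : I → Y →+ Y) (hπ : ∀ w γ, ∀ x ∈ piece γ, π γ (φ w x) = φ w x)
    (hπ' : ∀ w γ γ', γ' ≠ γ → ∀ x ∈ piece γ, π γ' (φ w x) = 0)
    (hφ : ∀ γ, ∀ x ∈ piece γ, (∀ w, φ w x = 0) → x = 0) (htop : ⨆ γ, piece γ = ⊤) :
    DirectSum.IsInternal piece := by
  constructor
  · rw [injective_iff_map_eq_zero]
    intro x hx
    -- After `φ w`, the map `π γ` keeps only the component of degree `γ`. A sum that vanishes thus
    -- has components killed by every `φ w`.
    have key : ∀ w γ (y : DirectSum I fun γ => piece γ),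
        π γ (φ w (DirectSum.coeAddMonoidHom piece y)) = φ w (y γ : X) := by
      intro w γ y
      induction y using DirectSum.induction_on with
      | zero => simp
      | of γ' z =>
        rw [DirectSum.coeAddMonoidHom_of]
        by_cases h : γ = γ'
        · subst h; rw [hπ _ _ _ z.2, DirectSum.of_eq_same]
        · rw [hπ' _ _ _ h _ z.2, DirectSum.of_eq_of_ne _ _ _ h]; exact (map_zero _).symm
      | add y z hy hz =>
        rw [map_add, map_add, map_add, hy, hz]
        exact (map_add (φ w) (y γ : X) (z γ)).symm
    refine DFinsupp.ext fun γ => Subtype.ext (hφ γ _ (x γ).2 fun w => ?_)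
    rw [← key, hx, map_zero, map_zero]
  · intro x
    have hx : x ∈ ⨆ γ, piece γ := htop ▸ AddSubgroup.mem_top x
    induction hx using AddSubgroup.iSup_induction' with
    | hp γ x hx => exact ⟨DirectSum.of (fun γ => piece γ) γ ⟨x, hx⟩, DirectSum.coeAddMonoidHom_of _ _ _⟩
    | h1 => exact ⟨0, map_zero _⟩
    | hadd x y _ _ hx hy =>
      obtain ⟨a, rfl⟩ := hx
      obtain ⟨b, rfl⟩ := hy
      exact ⟨a + b, map_add _ _ _⟩

open Classical in
theorem isInternal_of_proj (π : I → X →+ X) (hπ : ∀ γ, ∀ x ∈ piece γ, π γ x = x)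
    (hπ' : ∀ γ γ', γ' ≠ γ → ∀ x ∈ piece γ, π γ' x = 0) (htop : ⨆ γ, piece γ = ⊤) :
    DirectSum.IsInternal piece :=
  isInternal_of_separating (fun _ : Unit => AddMonoidHom.id X) π (fun _ => hπ) (fun _ => hπ')
    (fun _ _ _ h => h ()) htop

open Classical in
/-- The projection of a graded group onto one of its pieces. -/
def pieceProj (h : DirectSum.IsInternal piece) (γ : I) : X →+ X :=
  ((piece γ).subtype.comp (DFinsupp.evalAddMonoidHom γ)).comp
    (AddEquiv.ofBijective (DirectSum.coeAddMonoidHom piece) h).symm.toAddMonoidHom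

open Classical in
theorem pieceProj_mem (h : DirectSum.IsInternal piece) (γ : I) (x : X) :
    pieceProj h γ x ∈ piece γ := SetLike.coe_mem _

open Classical in
theorem pieceProj_apply_of_mem (h : DirectSum.IsInternal piece) {γ γ' : I} {x : X}
    (hx : x ∈ piece γ') : pieceProj h γ x = if γ = γ' then x else 0 := by
  have : (AddEquiv.ofBijective (DirectSum.coeAddMonoidHom piece) h).symm x =
      DirectSum.of (fun γ => piece γ) γ' ⟨x, hx⟩ := by
    rw [AddEquiv.symm_apply_eq]
    exact (DirectSum.coeAddMonoidHom_of piece γ' ⟨x, hx⟩).symm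
  change (((AddEquiv.ofBijective (DirectSum.coeAddMonoidHom piece) h).symm x) γ : X) = _
  rw [this]
  split_ifs with hγ
  · subst hγ; rw [DirectSum.of_eq_same]
  · rw [DirectSum.of_eq_of_ne _ _ _ hγ]; rfl

open Classical in
theorem pieceProj_of_mem (h : DirectSum.IsInternal piece) {γ : I} {x : X}
    (hx : x ∈ piece γ) : pieceProj h γ x = x := by
  rw [pieceProj_apply_of_mem h hx, if_pos rfl]

open Classical in
theorem isInternal_iSup_eq_top (h : DirectSum.IsInternal piece) : ⨆ γ, piece γ = ⊤ := by
  rw [eq_top_iff]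
  intro x _
  obtain ⟨y, rfl⟩ := h.2 x
  induction y using DirectSum.induction_on with
  | zero => rw [map_zero]; exact zero_mem _
  | of γ' z =>
    rw [DirectSum.coeAddMonoidHom_of]
    exact AddSubgroup.mem_iSup_of_mem γ' z.2
  | add y z hy hz =>
    rw [map_add]
    exact add_mem (hy trivial) (hz trivial)

open Classical in
/-- A homomorphism of graded groups that shifts degrees by an injective map commutes with the
projections to the pieces. -/
theorem map_pieceProj {J : Type w₃} {Y : Type w₄} [AddCommGroup Y] {piece' : J → AddSubgroup Y}
    (h : DirectSum.IsInternal piece) (h' : DirectSum.IsInternal piece') (g : X →+ Y) (τ : I → J)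
    (hτ : Function.Injective τ) (hg : ∀ γ, ∀ x ∈ piece γ, g x ∈ piece' (τ γ)) (γ : I) (x : X) :
    g (pieceProj h γ x) = pieceProj h' (τ γ) (g x) := by
  have hx : x ∈ ⨆ γ, piece γ := isInternal_iSup_eq_top h ▸ AddSubgroup.mem_top x
  induction hx using AddSubgroup.iSup_induction' with
  | hp γ' x hx =>
    rw [pieceProj_apply_of_mem h hx, pieceProj_apply_of_mem h' (hg _ _ hx)]
    by_cases e : γ = γ'
    · rw [if_pos e, if_pos (congrArg τ e)]
    · rw [if_neg e, if_neg (fun e' => e (hτ e')), map_zero]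
  | h1 => simp only [map_zero]
  | hadd x y _ _ hx hy => rw [map_add, map_add, hx, hy, map_add, map_add]

end Gradings

/-! ### The fine grading of the polynomial ring -/

section PolyPiece

variable {k : Type u} [Field k] {σ : Type v}

/-- The degree in `ℤ^σ` of the monomial with exponent `d`. -/
def expDegree (d : σ →₀ ℕ) : σ → ℤ := fun s => d s

theorem expDegree_add (d e : σ →₀ ℕ) : expDegree (d + e) = expDegree d + expDegree e :=
  funext fun s => by simp [expDegree]

theorem expDegree_zero : expDegree (0 : σ →₀ ℕ) = 0 := funext fun s => by simp [expDegree]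

theorem expDegree_injective : Function.Injective (expDegree : (σ →₀ ℕ) → σ → ℤ) := by
  intro d e h
  ext s
  exact Int.ofNat_inj.1 (congrFun h s)

open Classical in
theorem weight_single_eq (d : σ →₀ ℕ) :
    Finsupp.weight (fun s : σ => (Pi.single s 1 : σ → ℤ)) d = expDegree d := by
  funext s
  rw [Finsupp.weight_apply, Finsupp.sum, Finset.sum_apply]
  simp only [Pi.smul_apply, Pi.single_apply, smul_ite, smul_zero]
  rw [Finset.sum_ite_eq]
  by_cases h : s ∈ d.support
  · simp [h, expDegree]
  · simp only [h, if_false, expDegree]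
    exact (Int.ofNat_inj.2 (Finsupp.notMem_support_iff.1 h)).symm

theorem mem_polyPiece {α : σ → ℤ} {f : MvPolynomial σ k} :
    f ∈ polyPiece k α ↔ ∀ d, coeff d f ≠ 0 → expDegree d = α := by
  classical
  change f ∈ weightedHomogeneousSubmodule k _ α ↔ _
  rw [mem_weightedHomogeneousSubmodule]
  constructor
  · intro h d hd
    have := h hd
    rw [← weight_single_eq, ← this]
  · intro h d hd
    rw [← h d hd, ← weight_single_eq]

theorem monomial_mem_polyPiece (d : σ →₀ ℕ) (c : k) :
    monomial d c ∈ polyPiece k (expDegree d) := by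
  classical
  rw [mem_polyPiece]
  intro e he
  rw [coeff_monomial] at he
  split_ifs at he with h
  · rw [h]
  · exact absurd rfl he

/-- An exponent is determined by its degree, so each piece is at most one-dimensional. -/
theorem polyPiece_zero_or_monomial {α : σ → ℤ} {f : MvPolynomial σ k} (hf : f ∈ polyPiece k α) :
    f = 0 ∨ ∃ d c, expDegree d = α ∧ f = monomial d c := by
  rw [mem_polyPiece] at hf
  by_cases h : f = 0
  · exact Or.inl h
  · obtain ⟨d, hd⟩ := MvPolynomial.ne_zero_iff.1 h
    refine Or.inr ⟨d, coeff d f, hf d hd, ?_⟩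
    ext e
    classical
    rw [coeff_monomial]
    split_ifs with h
    · rw [h]
    · by_contra h'
      exact h (expDegree_injective ((hf d hd).trans (hf e h').symm))

theorem mul_mem_polyPiece {α β : σ → ℤ} {f g : MvPolynomial σ k} (hf : f ∈ polyPiece k α)
    (hg : g ∈ polyPiece k β) : f * g ∈ polyPiece k (α + β) := by
  obtain rfl | ⟨d, c, rfl, rfl⟩ := polyPiece_zero_or_monomial hf
  · rw [zero_mul]; exact zero_mem _
  obtain rfl | ⟨e, c', rfl, rfl⟩ := polyPiece_zero_or_monomial hg
  · rw [mul_zero]; exact zero_mem _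
  rw [monomial_mul, ← expDegree_add]
  exact monomial_mem_polyPiece _ _

theorem iSup_polyPiece : ⨆ α, polyPiece (σ := σ) k α = ⊤ := by
  rw [eq_top_iff]
  intro f _
  induction f using MvPolynomial.induction_on' with
  | monomial d c => exact AddSubgroup.mem_iSup_of_mem _ (monomial_mem_polyPiece d c)
  | add p q hp hq => exact add_mem (hp trivial) (hq trivial)

open Classical in
/-- The homogeneous component of degree `α` of a polynomial. -/
def polyProj (k : Type u) [Field k] {σ : Type v} (α : σ → ℤ) :
    MvPolynomial σ k →+ MvPolynomial σ k :=
  (weightedHomogeneousComponent (R := k) (fun s : σ => (Pi.single s 1 : σ → ℤ)) α).toAddMonoidHom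

open Classical in
theorem coeff_polyProj (α : σ → ℤ) (f : MvPolynomial σ k) (d : σ →₀ ℕ) :
    coeff d (polyProj k α f) = if expDegree d = α then coeff d f else 0 := by
  rw [← weight_single_eq]
  exact coeff_weightedHomogeneousComponent _ _ _

theorem polyProj_of_mem {α : σ → ℤ} {f : MvPolynomial σ k} (hf : f ∈ polyPiece k α) :
    polyProj k α f = f := by
  ext d
  rw [coeff_polyProj]
  split_ifs with h
  · rfl
  · exact (not_not.1 fun h' => h (mem_polyPiece.1 hf d (Ne.symm h')))

theorem polyProj_of_mem_ne {α β : σ → ℤ} (h : β ≠ α) {f : MvPolynomial σ k}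
    (hf : f ∈ polyPiece k α) : polyProj k β f = 0 := by
  ext d
  rw [coeff_polyProj, coeff_zero]
  split_ifs with h'
  · exact (not_not.1 fun h'' => h (h'.symm.trans (mem_polyPiece.1 hf d h'')))
  · rfl

end PolyPiece

/-! ### The Taylor resolution of a monomial ideal -/

section Taylor

variable {k : Type u} [Field k] {σ : Type v} {n : ℕ}

/-- The sign of a vertex in a face of the simplex with ordered vertices `Fin n`. -/
def faceSign (k : Type u) [Field k] {n : ℕ} (s : Fin n) (S : Finset (Fin n)) : k :=
  (-1) ^ (S.filter (· < s)).card

/-- Deleting the smaller vertex lowers by one the number of vertices below the larger; deleting the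
larger does not affect the smaller. The two orders of deletion thus differ by one sign. -/
theorem faceSign_erase_mul {s t : Fin n} {S : Finset (Fin n)} (hs : s ∈ S) (ht : t ∈ S)
    (hst : s ≠ t) :
    faceSign k s S * faceSign k t (S.erase s) + faceSign k t S * faceSign k s (S.erase t) = 0 := by
  wlog h : s < t generalizing s t
  · rw [add_comm]
    exact this ht hs hst.symm (lt_of_le_of_ne (not_lt.1 h) hst.symm)
  have h1 : faceSign k s (S.erase t) = faceSign k s S := by
    unfold faceSign
    rw [Finset.filter_erase, Finset.erase_eq_of_notMem]
    simp [h.le]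
  have h2 : faceSign k t S = - faceSign k t (S.erase s) := by
    unfold faceSign
    have hmem : s ∈ S.filter (· < t) := by simp [hs, h]
    rw [Finset.filter_erase, ← Finset.card_erase_add_one hmem, pow_succ]
    ring
  rw [h1, h2]
  ring

theorem faceSign_insert {s t : Fin n} {S : Finset (Fin n)} (h : t < s) (ht : t ∉ S) :
    faceSign k s (insert t S) = - faceSign k s S := by
  unfold faceSign
  rw [Finset.filter_insert, if_pos h, Finset.card_insert_of_notMem (by simp [ht]), pow_succ]
  ring

theorem faceSign_of_le {t : Fin n} {S : Finset (Fin n)} (h : ∀ s ∈ S, t ≤ s) :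
    faceSign k t S = 1 := by
  unfold faceSign
  rw [Finset.filter_eq_empty_iff.2 fun s hs => not_lt.2 (h s hs), Finset.card_empty, pow_zero]

variable (m : Fin n → σ →₀ ℕ)

/-- The exponent of the least common multiple of the monomials indexed by `S`. -/
def lcmExp (S : Finset (Fin n)) : σ →₀ ℕ := S.sup m

theorem lcmExp_mono {S S' : Finset (Fin n)} (h : S ⊆ S') : lcmExp m S ≤ lcmExp m S' :=
  Finset.sup_mono h

/-- The multiple of the generator indexed by `S` in degree `γ` with coefficient `c`. -/
def taylorMonomial (γ : σ →₀ ℕ) (S : Finset (Fin n)) (c : k) :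
    Finset (Fin n) →₀ MvPolynomial σ k :=
  Finsupp.single S (monomial (γ - lcmExp m S) c)

/-- The differential of the Taylor complex of the monomials with exponents `m j`, on the direct sum
of its terms. -/
def taylorD (k : Type u) [Field k] :
    (Finset (Fin n) →₀ MvPolynomial σ k) →ₗ[MvPolynomial σ k]
      (Finset (Fin n) →₀ MvPolynomial σ k) :=
  Finsupp.linearCombination _ fun S => ∑ s ∈ S,
    taylorMonomial m (lcmExp m S) (S.erase s) (faceSign k s S)

/-- Once the degree `γ` is fixed, the monomial in front of each generator is forced, and the
differential becomes the signed boundary of a simplex. -/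
theorem taylorD_taylorMonomial {γ : σ →₀ ℕ} {S : Finset (Fin n)} (h : lcmExp m S ≤ γ) (c : k) :
    taylorD m k (taylorMonomial m γ S c) =
      ∑ s ∈ S, taylorMonomial m γ (S.erase s) (c * faceSign k s S) := by
  rw [taylorD, taylorMonomial, Finsupp.linearCombination_single, Finset.smul_sum]
  refine Finset.sum_congr rfl fun s _ => ?_
  rw [taylorMonomial, taylorMonomial, Finsupp.smul_single, smul_eq_mul, monomial_mul,
    tsub_add_tsub_cancel h (lcmExp_mono m (Finset.erase_subset _ _))]

theorem single_eq_taylorMonomial (S : Finset (Fin n)) (d : σ →₀ ℕ) (c : k) :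
    Finsupp.single S (monomial d c) = taylorMonomial m (d + lcmExp m S) S c := by
  rw [taylorMonomial, add_tsub_cancel_right]

theorem taylorD_comp_taylorD : taylorD m k ∘ₗ taylorD m k = 0 := by
  refine Finsupp.lhom_ext' fun S => LinearMap.ext_ring ?_
  change taylorD m k (taylorD m k (Finsupp.single S (monomial 0 1))) = 0
  rw [single_eq_taylorMonomial m, taylorD_taylorMonomial m (by simp), map_sum]
  rw [Finset.sum_congr rfl fun s _ => taylorD_taylorMonomial m
    ((lcmExp_mono m (Finset.erase_subset _ _)).trans (by simp)) _, Finset.sum_sigma']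
  -- Each face with two vertices removed occurs twice, once for each order of removal, with opposite
  -- signs.
  refine Finset.sum_involution (fun x _ => ⟨x.2, x.1⟩) ?_ ?_ ?_ ?_
  · rintro ⟨s, t⟩ h
    simp only [Finset.mem_sigma, Finset.mem_erase] at h
    dsimp only
    rw [Finset.erase_right_comm, taylorMonomial, taylorMonomial, ← Finsupp.single_add,
      ← map_add, one_mul, one_mul, faceSign_erase_mul h.1 h.2.2 h.2.1.symm, map_zero,
      Finsupp.single_zero]
  · rintro ⟨s, t⟩ h _ h'
    simp only [Finset.mem_sigma, Finset.mem_erase] at h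
    simp only [Sigma.mk.injEq, heq_eq_eq] at h'
    exact h.2.1 h'.1
  · rintro ⟨s, t⟩ h
    simp only [Finset.mem_sigma, Finset.mem_erase] at h ⊢
    exact ⟨h.2.2, h.2.1.symm, h.1⟩
  · rintro ⟨s, t⟩ h
    rfl

/-- The indices of the monomials dividing the monomial with exponent `γ`. -/
def divisors (γ : σ →₀ ℕ) : Finset (Fin n) := by
  classical exact Finset.univ.filter (m · ≤ γ)

theorem mem_divisors {γ : σ →₀ ℕ} {j : Fin n} : j ∈ divisors m γ ↔ m j ≤ γ := by
  simp [divisors]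

theorem subset_divisors {γ : σ →₀ ℕ} {S : Finset (Fin n)} :
    S ⊆ divisors m γ ↔ lcmExp m S ≤ γ := by
  rw [lcmExp, Finset.sup_le_iff]
  exact forall₂_congr fun j _ => mem_divisors m

/-- The values of the contracting homotopy of the Taylor complex. -/
def taylorHomotopyFun (k : Type u) [Field k] (γ : σ →₀ ℕ) (S : Finset (Fin n)) :
    Finset (Fin n) →₀ MvPolynomial σ k :=
  if h : (divisors m γ).Nonempty then
    if (divisors m γ).min' h ∈ S then 0
    else taylorMonomial m γ (insert ((divisors m γ).min' h) S) 1
  else 0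

/-- A contracting homotopy of the Taylor complex. -/
def taylorHomotopy (k : Type u) [Field k] :
    (Finset (Fin n) →₀ MvPolynomial σ k) →ₗ[k] (Finset (Fin n) →₀ MvPolynomial σ k) :=
  Finsupp.lsum k fun S => (basisMonomials σ k).constr k fun d =>
    taylorHomotopyFun m k (d + lcmExp m S) S

theorem taylorHomotopy_taylorMonomial {γ : σ →₀ ℕ} {S : Finset (Fin n)} (h : lcmExp m S ≤ γ)
    (c : k) :
    taylorHomotopy m k (taylorMonomial m γ S c) = c • taylorHomotopyFun m k γ S := by
  rw [taylorHomotopy, taylorMonomial, Finsupp.lsum_single]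
  have : monomial (γ - lcmExp m S) c = c • basisMonomials σ k (γ - lcmExp m S) := by
    rw [coe_basisMonomials, smul_monomial, smul_eq_mul, mul_one]
  rw [this, map_smul, Module.Basis.constr_basis, tsub_add_cancel_of_le h]

theorem taylorMonomial_smul (c c' : k) (γ : σ →₀ ℕ) (S : Finset (Fin n)) :
    c • taylorMonomial m γ S c' = taylorMonomial m γ S (c * c') := by
  rw [taylorMonomial, taylorMonomial, Finsupp.smul_single, smul_monomial, smul_eq_mul]

/-- In degree `γ` the complex is the augmented chain complex of the full simplex on the generators
dividing $x^\gamma$. If there are any, this simplex is a cone over its least vertex `t`, and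
inserting `t` contracts it. -/
theorem taylor_homotopy_taylorMonomial {γ : σ →₀ ℕ} {S : Finset (Fin n)} (h : lcmExp m S ≤ γ)
    (hγ : (divisors m γ).Nonempty) (c : k) :
    taylorD m k (taylorHomotopy m k (taylorMonomial m γ S c)) +
      taylorHomotopy m k (taylorD m k (taylorMonomial m γ S c)) = taylorMonomial m γ S c := by
  have hsub := (subset_divisors m).2 h
  set t := (divisors m γ).min' hγ with ht
  have htmin : ∀ s ∈ S, t ≤ s := fun s hs => Finset.min'_le _ _ (hsub hs)
  have hle : ∀ s, lcmExp m (S.erase s) ≤ γ := fun s =>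
    (lcmExp_mono m (Finset.erase_subset _ _)).trans h
  have hfun : ∀ S', taylorHomotopyFun m k γ S' =
      if t ∈ S' then 0 else taylorMonomial m γ (insert t S') 1 := fun S' => dif_pos hγ
  rw [taylorHomotopy_taylorMonomial m h, taylorD_taylorMonomial m h, map_sum,
    Finset.sum_congr rfl fun s _ => taylorHomotopy_taylorMonomial m (hle s) _, hfun]
  -- If `t ∈ S`, the homotopy kills `S` and all its faces except the one opposite `t`, which returns
  -- `S`. If not, deleting `t` from `insert t S` returns `S`, and the other terms cancel because
  -- inserting `t` flips their signs.
  by_cases htS : t ∈ S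
  · rw [if_pos htS, smul_zero, map_zero, zero_add, Finset.sum_eq_single t]
    · rw [hfun, if_neg (Finset.notMem_erase _ _), Finset.insert_erase htS, taylorMonomial_smul,
        faceSign_of_le htmin, mul_one, mul_one]
    · intro s _ hs
      rw [hfun, if_pos (Finset.mem_erase.2 ⟨hs.symm, htS⟩), smul_zero]
    · intro h'; exact absurd htS h'
  · have hins : lcmExp m (insert t S) ≤ γ := by
      rw [← subset_divisors, Finset.insert_subset_iff]
      exact ⟨Finset.min'_mem _ _, hsub⟩
    rw [if_neg htS, taylorMonomial_smul, taylorD_taylorMonomial m hins, Finset.sum_insert htS,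
      Finset.erase_insert htS, faceSign_of_le (by simpa using htmin), mul_one, mul_one, add_assoc,
      ← Finset.sum_add_distrib, Finset.sum_eq_zero, add_zero]
    intro s hs
    have hts : t < s := lt_of_le_of_ne (htmin s hs) fun e => htS (e ▸ hs)
    rw [hfun, if_neg fun h' => htS (Finset.mem_of_mem_erase h'), taylorMonomial_smul,
      Finset.erase_insert_of_ne hts.ne, faceSign_insert hts htS, taylorMonomial, taylorMonomial,
      ← Finsupp.single_add, ← map_add, mul_one, mul_neg, neg_add_cancel, map_zero,
      Finsupp.single_zero]

theorem finsupp_poly_induction {p : (Finset (Fin n) →₀ MvPolynomial σ k) → Prop}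
    (Q : Finset (Fin n) → Prop) (h0 : p 0) (hadd : ∀ x y, p x → p y → p (x + y))
    (hmon : ∀ S d c, Q S → p (taylorMonomial m (d + lcmExp m S) S c))
    (x : Finset (Fin n) →₀ MvPolynomial σ k) (hx : ∀ S, x S ≠ 0 → Q S) : p x := by
  have : x = ∑ S ∈ x.support, Finsupp.single S (x S) := (Finsupp.sum_single x).symm
  rw [this]
  refine Finset.sum_induction _ p hadd h0 fun S hS => ?_
  have hQ : Q S := hx S (Finsupp.mem_support_iff.1 hS)
  generalize x S = a
  induction a using MvPolynomial.induction_on' with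
  | monomial d c => rw [single_eq_taylorMonomial m]; exact hmon S d c hQ
  | add a b ha hb => rw [Finsupp.single_add]; exact hadd _ _ ha hb

/-- The empty face is excluded: in a degree divisible by no generator it is the only face, and such
degrees survive in the quotient by the ideal. -/
theorem taylor_homotopy (x : Finset (Fin n) →₀ MvPolynomial σ k)
    (hx : ∀ S, x S ≠ 0 → S.Nonempty) :
    taylorD m k (taylorHomotopy m k x) + taylorHomotopy m k (taylorD m k x) = x := by
  refine finsupp_poly_induction m (p := fun x => taylorD m k (taylorHomotopy m k x) +
    taylorHomotopy m k (taylorD m k x) = x) (·.Nonempty) (by simp) ?_ ?_ x hx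
  · intro x y hx hy
    conv_rhs => rw [← hx, ← hy]
    simp only [map_add]
    abel
  · rintro S d c ⟨s, hs⟩
    have h : lcmExp m S ≤ d + lcmExp m S := le_add_self
    exact taylor_homotopy_taylorMonomial m h ⟨s, (subset_divisors m).2 h hs⟩ c

/-- The terms of the Taylor complex. -/
abbrev taylorX (k : Type u) [Field k] (σ : Type v) (n p : ℕ) :
    Submodule (MvPolynomial σ k) (Finset (Fin n) →₀ MvPolynomial σ k) :=
  Finsupp.supported _ _ {S | S.card = p}

theorem mem_taylorX {p : ℕ} {x : Finset (Fin n) →₀ MvPolynomial σ k} :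
    x ∈ taylorX k σ n p ↔ ∀ S, x S ≠ 0 → S.card = p := by
  rw [taylorX, Finsupp.mem_supported]
  exact forall_congr' fun S => imp_congr_left (by simp)

theorem taylorMonomial_mem {p : ℕ} (γ : σ →₀ ℕ) {S : Finset (Fin n)} (hS : S.card = p) (c : k) :
    taylorMonomial m γ S c ∈ taylorX k σ n p :=
  Finsupp.single_mem_supported _ _ hS

theorem taylorD_mem {p : ℕ} {x : Finset (Fin n) →₀ MvPolynomial σ k}
    (hx : x ∈ taylorX k σ n (p + 1)) : taylorD m k x ∈ taylorX k σ n p := by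
  refine finsupp_poly_induction m (p := fun x => taylorD m k x ∈ taylorX k σ n p)
    (·.card = p + 1) (by simp) ?_ ?_ x (mem_taylorX.1 hx)
  · intro x y hx hy
    rw [map_add]; exact add_mem hx hy
  · intro S d c hS
    rw [taylorD_taylorMonomial m le_add_self]
    exact sum_mem fun s hs => taylorMonomial_mem m _ (by rw [Finset.card_erase_of_mem hs, hS]; rfl) _

theorem taylorHomotopy_mem {p : ℕ} {x : Finset (Fin n) →₀ MvPolynomial σ k}
    (hx : x ∈ taylorX k σ n p) : taylorHomotopy m k x ∈ taylorX k σ n (p + 1) := by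
  refine finsupp_poly_induction m (p := fun x => taylorHomotopy m k x ∈ taylorX k σ n (p + 1))
    (·.card = p) (by simp) ?_ ?_ x (mem_taylorX.1 hx)
  · intro x y hx hy
    rw [map_add]; exact add_mem hx hy
  · intro S d c hS
    rw [taylorHomotopy_taylorMonomial m le_add_self, taylorHomotopyFun]
    split_ifs with h h'
    · rw [smul_zero]; exact zero_mem _
    · rw [taylorMonomial_smul]
      exact taylorMonomial_mem m _ (by rw [Finset.card_insert_of_notMem h', hS]) _
    · rw [smul_zero]; exact zero_mem _

theorem taylor_exact {p : ℕ} {x : Finset (Fin n) →₀ MvPolynomial σ k}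
    (hx : x ∈ taylorX k σ n (p + 1)) (hd : taylorD m k x = 0) :
    ∃ y ∈ taylorX k σ n (p + 2), taylorD m k y = x := by
  refine ⟨_, taylorHomotopy_mem m hx, ?_⟩
  have := taylor_homotopy m x fun S hS =>
    Finset.card_pos.1 (by rw [mem_taylorX.1 hx S hS]; exact p.succ_pos)
  rwa [hd, map_zero, add_zero] at this

/-- The ideal generated by the monomials with exponents `m j`. -/
def monomialIdeal (k : Type u) [Field k] : Ideal (MvPolynomial σ k) :=
  Ideal.span (Set.range fun j => monomial (m j) 1)

theorem taylorD_single_singleton (j : Fin n) (a : MvPolynomial σ k) :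
    taylorD m k (Finsupp.single {j} a) = Finsupp.single ∅ (a * monomial (m j) 1) := by
  rw [taylorD, Finsupp.linearCombination_single, Finset.sum_singleton, taylorMonomial,
    Finsupp.smul_single, smul_eq_mul, faceSign_of_le (by simp)]
  simp [lcmExp, bot_eq_zero]

theorem taylor_exact_zero {f : MvPolynomial σ k} (hf : f ∈ monomialIdeal m k) :
    ∃ y ∈ taylorX k σ n 1, taylorD m k y = Finsupp.single ∅ f := by
  rw [monomialIdeal, Ideal.mem_span_range_iff_exists_fun] at hf
  obtain ⟨c, rfl⟩ := hf
  refine ⟨∑ j, Finsupp.single {j} (c j),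
    sum_mem fun j _ => Finsupp.single_mem_supported _ _ (Finset.card_singleton j), ?_⟩
  rw [map_sum, Finset.sum_congr rfl fun j _ => taylorD_single_singleton m j (c j),
    Finsupp.single_finsetSum]

theorem taylorD_apply_empty {y : Finset (Fin n) →₀ MvPolynomial σ k}
    (hy : y ∈ taylorX k σ n 1) : taylorD m k y ∅ ∈ monomialIdeal m k := by
  refine finsupp_poly_induction m (p := fun x => taylorD m k x ∅ ∈ monomialIdeal m k)
    (·.card = 1) (by simp) ?_ ?_ y (mem_taylorX.1 hy)
  · intro x y hx hy
    rw [map_add]; exact add_mem hx hy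
  · intro S d c hS
    obtain ⟨s, rfl⟩ := Finset.card_eq_one.1 hS
    rw [← single_eq_taylorMonomial, taylorD_single_singleton, Finsupp.single_eq_same]
    exact Ideal.mul_mem_left _ _ (Ideal.subset_span ⟨s, rfl⟩)

section Resolution

variable (k)

/-- The Taylor complex. -/
def taylorComplex : ChainComplex (ModuleCat.{max u v} (MvPolynomial σ k)) ℕ :=
  ChainComplex.of (fun p => ModuleCat.of (MvPolynomial σ k) (taylorX k σ n p))
    (fun p => ModuleCat.ofHom ((taylorD m k).restrict fun _ hx => taylorD_mem m hx))
    (fun p => by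
      refine ModuleCat.hom_ext (LinearMap.ext fun x => Subtype.ext ?_)
      exact LinearMap.congr_fun (taylorD_comp_taylorD m) x.1)

theorem taylorComplex_d (p : ℕ) (x : taylorX k σ n (p + 1)) :
    (((taylorComplex k m).d (p + 1) p).hom x : taylorX k σ n p).1 = taylorD m k x.1 := by
  have : (taylorComplex k m).d (p + 1) p =
      ModuleCat.ofHom ((taylorD m k).restrict fun _ hx => taylorD_mem m hx) := by
    unfold taylorComplex
    exact ChainComplex.of_d (fun p => ModuleCat.of (MvPolynomial σ k) (taylorX k σ n p))
      (fun p => ModuleCat.ofHom ((taylorD m k).restrict fun _ hx => taylorD_mem m hx)) p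
  rw [this]
  rfl

instance (p : ℕ) : Projective ((taylorComplex k m).X p) := by
  have : Module.Projective (MvPolynomial σ k) (taylorX k σ n p) :=
    Module.Projective.of_equiv (Finsupp.supportedEquivFinsupp
      (M := MvPolynomial σ k) (R := MvPolynomial σ k) {S : Finset (Fin n) | S.card = p}).symm
  exact (IsProjective.iff_projective (taylorX k σ n p)).1 this

/-- The augmentation of the Taylor complex. -/
def taylorAugmentation (J : Ideal (MvPolynomial σ k)) :
    taylorX k σ n 0 →ₗ[MvPolynomial σ k] MvPolynomial σ k ⧸ J :=
  (Submodule.mkQ (J) ∘ₗ Finsupp.lapply ∅) ∘ₗ (taylorX k σ n 0).subtype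

theorem taylorComplex_d_comp_augmentation {J : Ideal (MvPolynomial σ k)}
    (hJ : monomialIdeal m k = J) :
    (taylorComplex k m).d 1 0 ≫ (ModuleCat.ofHom (taylorAugmentation k J) :
      (taylorComplex k m).X 0 ⟶ ModuleCat.of _ (MvPolynomial σ k ⧸ J)) = 0 := by
  ext x
  have h := taylorComplex_d k m 0 x
  change Submodule.Quotient.mk ((((taylorComplex k m).d 1 0).hom x : taylorX k σ n 0).1 ∅) = _
  rw [h]
  exact (Submodule.Quotient.mk_eq_zero _).2 (hJ ▸ taylorD_apply_empty m x.2)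

theorem eq_single_empty {x : Finset (Fin n) →₀ MvPolynomial σ k} (hx : x ∈ taylorX k σ n 0) :
    x = Finsupp.single ∅ (x ∅) := by
  ext1 S
  by_cases h : S = ∅
  · rw [h, Finsupp.single_eq_same]
  · rw [Finsupp.single_eq_of_ne h]
    by_contra h'
    exact h (Finset.card_eq_zero.1 (mem_taylorX.1 hx S h'))

/-- The Taylor resolution of the quotient by a monomial ideal. -/
def taylorResolution {J : Ideal (MvPolynomial σ k)} (hJ : monomialIdeal m k = J) :
    ProjectiveResolution (ModuleCat.of (MvPolynomial σ k) (MvPolynomial σ k ⧸ J)) where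
  complex := taylorComplex k m
  π := (ChainComplex.toSingle₀Equiv _ _).symm ⟨ModuleCat.ofHom (taylorAugmentation k J),
    taylorComplex_d_comp_augmentation k m hJ⟩
  quasiIso := ⟨fun p => by
    cases p with
    | zero =>
      -- In degree zero the claim is that the first differential followed by the augmentation is
      -- exact, with the augmentation surjective.
      rw [ChainComplex.quasiIsoAt₀_iff, ShortComplex.quasiIso_iff_of_zeros']
      · refine (ShortComplex.exact_and_epi_g_iff_of_iso
          (S₂ := ShortComplex.mk _ _ (taylorComplex_d_comp_augmentation k m hJ)) ?_).2 ⟨?_, ?_⟩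
        · refine ShortComplex.isoMk (Iso.refl _) (Iso.refl _) (Iso.refl _)
            ((Category.id_comp _).trans (Category.comp_id _).symm) ?_
          refine (Category.id_comp _).trans (Eq.trans ?_ (Category.comp_id _).symm)
          exact (ChainComplex.toSingle₀Equiv_symm_apply_f_zero (C := taylorComplex k m) _
            (taylorComplex_d_comp_augmentation k m hJ)).symm
        · rw [ShortComplex.moduleCat_exact_iff]
          intro x hx
          obtain ⟨y, hy, hyx⟩ := taylor_exact_zero m
            (hJ ▸ (Submodule.Quotient.mk_eq_zero J).1 hx)
          exact ⟨⟨y, hy⟩, Subtype.ext ((taylorComplex_d k m 0 ⟨y, hy⟩).trans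
            (hyx.trans (eq_single_empty k x.2).symm))⟩
        · refine (ModuleCat.epi_iff_surjective _).2 fun q => ?_
          obtain ⟨f, rfl⟩ := Submodule.Quotient.mk_surjective _ q
          exact ⟨⟨Finsupp.single ∅ f, Finsupp.single_mem_supported _ _ Finset.card_empty⟩,
            congrArg _ Finsupp.single_eq_same⟩
      all_goals rfl
    | succ p =>
      rw [quasiIsoAt_iff_exactAt' _ _ (ChainComplex.exactAt_succ_single_obj _ _),
        HomologicalComplex.exactAt_iff' _ (p + 2) (p + 1) p (by simp) (by simp),
        ShortComplex.moduleCat_exact_iff]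
      intro x hx
      obtain ⟨y, hy, hyx⟩ := taylor_exact m (x := x.1) x.2
        ((taylorComplex_d k m p x).symm.trans (congrArg Subtype.val hx))
      exact ⟨⟨y, hy⟩, Subtype.ext ((taylorComplex_d k m (p + 1) ⟨y, hy⟩).trans hyx)⟩⟩

end Resolution

end Taylor

/-! ### The Taylor resolution as a graded resolution -/

section TaylorGrading

variable {k : Type u} [Field k] {σ : Type v} {n : ℕ} (m : Fin n → σ →₀ ℕ)

/-- The degree in `ℤ^σ` of the generator of the Taylor complex indexed by `S`. -/
def lcmDegree (S : Finset (Fin n)) : σ → ℤ := expDegree (lcmExp m S)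

/-- The pieces of the terms of the Taylor complex. -/
def taylorPiece (k : Type u) [Field k] (p : ℕ) (γ : σ → ℤ) : AddSubgroup (taylorX k σ n p) where
  carrier := {x | ∀ S, x.1 S ∈ polyPiece k (γ - lcmDegree m S)}
  zero_mem' _ := zero_mem _
  add_mem' hx hy S := add_mem (hx S) (hy S)
  neg_mem' hx S := neg_mem (hx S)

theorem taylorMonomial_mem_piece {p : ℕ} {γ : σ →₀ ℕ} {S : Finset (Fin n)} (hS : S.card = p)
    (h : lcmExp m S ≤ γ) (c : k) :
    (⟨taylorMonomial m γ S c, taylorMonomial_mem m γ hS c⟩ : taylorX k σ n p) ∈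
      taylorPiece m k p (expDegree γ) := by
  intro S'
  change taylorMonomial m γ S c S' ∈ _
  rw [taylorMonomial]
  by_cases e : S' = S
  · subst e
    rw [Finsupp.single_eq_same]
    have : expDegree γ - lcmDegree m S' = expDegree (γ - lcmExp m S') := by
      conv_lhs => rw [← tsub_add_cancel_of_le h, expDegree_add, lcmDegree, add_sub_cancel_right]
    rw [this]
    exact monomial_mem_polyPiece _ _
  · rw [Finsupp.single_eq_of_ne e]; exact zero_mem _

/-- The homogeneous components of an element of the Taylor complex. -/
def taylorProj (k : Type u) [Field k] (p : ℕ) (γ : σ → ℤ) :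
    taylorX k σ n p →+ taylorX k σ n p where
  toFun x := ⟨Finsupp.equivFunOnFinite.symm fun S => polyProj k (γ - lcmDegree m S) (x.1 S),
    mem_taylorX.2 fun S hS => mem_taylorX.1 x.2 S fun h => hS (by
      change polyProj k _ (x.1 S) = 0
      rw [h, map_zero])⟩
  map_zero' := Subtype.ext (Finsupp.ext fun S => map_zero (polyProj k (γ - lcmDegree m S)))
  map_add' x y := Subtype.ext (Finsupp.ext fun S =>
    map_add (polyProj k (γ - lcmDegree m S)) (x.1 S) (y.1 S))

theorem iSup_taylorPiece (p : ℕ) : ⨆ γ, taylorPiece m k p γ = ⊤ := by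
  rw [eq_top_iff]
  intro x _
  suffices h : x.1 ∈ (⨆ γ, taylorPiece m k p γ).map (taylorX k σ n p).subtype.toAddMonoidHom by
    obtain ⟨y, hy, hyx⟩ := h
    exact (Subtype.ext hyx : y = x) ▸ hy
  refine finsupp_poly_induction m
    (p := (· ∈ (⨆ γ, taylorPiece m k p γ).map (taylorX k σ n p).subtype.toAddMonoidHom))
    (·.card = p) (AddSubgroup.zero_mem _) (fun _ _ => AddSubgroup.add_mem _) ?_ x.1
    (mem_taylorX.1 x.2)
  intro S d c hS
  exact ⟨_, AddSubgroup.mem_iSup_of_mem _ (taylorMonomial_mem_piece m hS le_add_self c), rfl⟩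

open Classical in
theorem taylorPiece_isInternal (p : ℕ) : DirectSum.IsInternal (taylorPiece m k p) := by
  refine isInternal_of_proj (taylorProj m k p) (fun γ x hx => ?_) (fun γ γ' h x hx => ?_)
    (iSup_taylorPiece m p)
  · exact Subtype.ext (Finsupp.ext fun S => polyProj_of_mem (hx S))
  · exact Subtype.ext (Finsupp.ext fun S =>
      polyProj_of_mem_ne (fun e => h (sub_left_injective e)) (hx S))

theorem smul_mem_taylorPiece {p : ℕ} {β γ : σ → ℤ} {a : MvPolynomial σ k} {x : taylorX k σ n p}
    (ha : a ∈ polyPiece k β) (hx : x ∈ taylorPiece m k p γ) :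
    a • x ∈ taylorPiece m k p (β + γ) := by
  intro S
  rw [add_sub_assoc]
  exact mul_mem_polyPiece ha (hx S)

/-- An additive property of homogeneous elements of the Taylor complex holds if it holds for the
monomials in its generators. -/
theorem taylorPiece_induction {p : ℕ} {γ : σ → ℤ} {P : taylorX k σ n p → Prop} (h0 : P 0)
    (hadd : ∀ x y, P x → P y → P (x + y))
    (hmon : ∀ (d : σ →₀ ℕ) (S : Finset (Fin n)) (hS : S.card = p) (c : k), expDegree d = γ →
      lcmExp m S ≤ d → P ⟨taylorMonomial m d S c, taylorMonomial_mem m d hS c⟩)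
    {x : taylorX k σ n p} (hx : x ∈ taylorPiece m k p γ) : P x := by
  have key : ∀ S, x.1 S ≠ 0 → ∃ d c, ∃ hS : S.card = p, expDegree d = γ ∧ lcmExp m S ≤ d ∧
      Finsupp.single S (x.1 S) = taylorMonomial m d S c := by
    intro S hS
    obtain h | ⟨d, c, hd, hdc⟩ := polyPiece_zero_or_monomial (hx S)
    · exact absurd h hS
    · refine ⟨d + lcmExp m S, c, mem_taylorX.1 x.2 S hS, ?_, le_add_self, ?_⟩
      · rw [expDegree_add, hd, lcmDegree, sub_add_cancel]
      · rw [hdc, single_eq_taylorMonomial m]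
  have hsum : ∀ s : Finset (Finset (Fin n)), s ⊆ x.1.support →
      ∃ hm : ∑ S ∈ s, Finsupp.single S (x.1 S) ∈ taylorX k σ n p, P ⟨_, hm⟩ := by
    intro s
    induction s using Finset.cons_induction with
    | empty => exact fun _ => ⟨zero_mem _, h0⟩
    | cons S s hS ih =>
      intro hs
      obtain ⟨hm, hP⟩ := ih ((Finset.subset_cons hS).trans hs)
      obtain ⟨d, c, hSp, hd, hle, heq⟩ :=
        key S (Finsupp.mem_support_iff.1 (hs (Finset.mem_cons_self S s)))
      have e : ∑ S ∈ Finset.cons S s hS, Finsupp.single S (x.1 S) =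
        taylorMonomial m d S c + ∑ S ∈ s, Finsupp.single S (x.1 S) := by
        rw [Finset.sum_cons, heq]
      have := hadd _ _ (hmon d S hSp c hd hle) hP
      exact ⟨e ▸ add_mem (taylorMonomial_mem m d hSp c) hm, by
        convert this using 1
        exact Subtype.ext e⟩
  obtain ⟨hm, hP⟩ := hsum _ subset_rfl
  convert hP using 1
  exact Subtype.ext (Finsupp.sum_single x.1).symm

theorem taylorD_mem_piece {p : ℕ} {γ : σ → ℤ} {x : taylorX k σ n (p + 1)}
    (hx : x ∈ taylorPiece m k (p + 1) γ) :
    (⟨taylorD m k x.1, taylorD_mem m x.2⟩ : taylorX k σ n p) ∈ taylorPiece m k p γ := by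
  refine taylorPiece_induction m (P := fun x =>
    (⟨taylorD m k x.1, taylorD_mem m x.2⟩ : taylorX k σ n p) ∈ taylorPiece m k p γ) ?_ ?_ ?_ hx
  · convert zero_mem (taylorPiece m k p γ) using 1
    exact Subtype.ext (map_zero _)
  · intro x y hx hy
    convert add_mem hx hy using 1
    exact Subtype.ext (map_add _ _ _)
  · rintro d S hS c rfl hle S'
    change taylorD m k (taylorMonomial m d S c) S' ∈ _
    rw [taylorD_taylorMonomial m hle, Finsupp.finsetSum_apply]
    refine sum_mem fun s hs => ?_
    exact taylorMonomial_mem_piece m (p := p)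
      (by rw [Finset.card_erase_of_mem hs, hS]; rfl)
      ((lcmExp_mono m (Finset.erase_subset _ _)).trans hle) _ S'

theorem lcmDegree_empty : lcmDegree m ∅ = 0 := by
  rw [lcmDegree, lcmExp, Finset.sup_empty, bot_eq_zero, expDegree_zero]

/-- The Taylor resolution of the quotient by a monomial ideal as a graded resolution. -/
def taylorGradedResolution {J : Ideal (MvPolynomial σ k)} (hJ : monomialIdeal m k = J) :
    GradedResolution (ModuleCat.of (MvPolynomial σ k) (MvPolynomial σ k ⧸ J))
      (quotientPiece J) where
  res := taylorResolution k m hJ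
  piece := taylorPiece m k
  isInternal := taylorPiece_isInternal m
  smul_mem _ _ _ _ _ ha hx := smul_mem_taylorPiece m ha hx
  d_mem p β x hx := by
    have e : (((taylorComplex k m).d (p + 1) p).hom x : taylorX k σ n p) =
        ⟨taylorD m k x.1, taylorD_mem m x.2⟩ := Subtype.ext (taylorComplex_d k m p x)
    change (((taylorComplex k m).d (p + 1) p).hom x : taylorX k σ n p) ∈ taylorPiece m k p β
    rw [e]
    exact taylorD_mem_piece m hx
  augmentation_mem β x hx := by
    have h := hx ∅
    rw [lcmDegree_empty, sub_zero] at h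
    refine ⟨_, h, ?_⟩
    have : (taylorResolution k m hJ).π.f 0 = ModuleCat.ofHom (taylorAugmentation k J) :=
      ChainComplex.toSingle₀Equiv_symm_apply_f_zero (C := taylorComplex k m) _ _
    rw [this]
    rfl

end TaylorGrading

/-! ### Gradings of quotients by monomial ideals -/

section QuotientGrading

-- The kernel is stable under the projections, so they descend to the image; the preimage used to
-- define them does not matter.
open Classical in
theorem isInternal_map {I X Y : Type*} [AddCommGroup X] [AddCommGroup Y]
    {piece : I → AddSubgroup X} (h : DirectSum.IsInternal piece) (f : X →+ Y)
    (hf : Function.Surjective f) (hker : ∀ γ x, f x = 0 → f (pieceProj h γ x) = 0) :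
    DirectSum.IsInternal fun γ => (piece γ).map f := by
  have hs := Function.surjInv_eq hf
  have hπ : ∀ γ x, f (pieceProj h γ (Function.surjInv hf (f x))) = f (pieceProj h γ x) := by
    intro γ x
    rw [← sub_eq_zero, ← map_sub, ← map_sub]
    exact hker _ _ (by rw [map_sub, hs, sub_self])
  let π : I → Y →+ Y := fun γ =>
    { toFun := fun y => f (pieceProj h γ (Function.surjInv hf y))
      map_zero' := by
        have := hπ γ 0
        rwa [map_zero, map_zero, map_zero] at this
      map_add' := fun x y => by
        obtain ⟨x, rfl⟩ := hf x
        obtain ⟨y, rfl⟩ := hf y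
        rw [← map_add, hπ, hπ, hπ, map_add, map_add] }
  refine isInternal_of_proj π ?_ ?_ ?_
  · rintro γ _ ⟨x, hx, rfl⟩
    exact (hπ γ x).trans (congrArg f (pieceProj_of_mem h hx))
  · rintro γ γ' hγ _ ⟨x, hx, rfl⟩
    refine (hπ γ' x).trans ?_
    rw [pieceProj_apply_of_mem h hx, if_neg hγ, map_zero]
  · rw [← AddSubgroup.map_iSup, isInternal_iSup_eq_top h, ← AddMonoidHom.range_eq_map,
      AddMonoidHom.range_eq_top.2 hf]

variable {k : Type u} [Field k] {σ : Type v}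

open Classical in
theorem polyPiece_isInternal : DirectSum.IsInternal (polyPiece (σ := σ) k) :=
  isInternal_of_proj (polyProj k) (fun _ _ => polyProj_of_mem)
    (fun _ _ h _ => polyProj_of_mem_ne h) iSup_polyPiece

open Classical in
theorem pieceProj_polyPiece (γ : σ → ℤ) (f : MvPolynomial σ k) :
    pieceProj polyPiece_isInternal γ f = polyProj k γ f := by
  induction f using MvPolynomial.induction_on' with
  | monomial d c =>
    rw [pieceProj_apply_of_mem _ (monomial_mem_polyPiece d c)]
    split_ifs with h
    · rw [h, polyProj_of_mem (monomial_mem_polyPiece d c)]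
    · rw [polyProj_of_mem_ne h (monomial_mem_polyPiece d c)]
  | add p q hp hq => rw [map_add, map_add, hp, hq]

theorem mem_monomialIdeal {n : ℕ} {m : Fin n → σ →₀ ℕ} {f : MvPolynomial σ k} :
    f ∈ monomialIdeal m k ↔ ∀ d, coeff d f ≠ 0 → ∃ j, m j ≤ d := by
  have : monomialIdeal m k = Ideal.span ((fun s => monomial s (1 : k)) '' Set.range m) := by
    rw [monomialIdeal, ← Set.range_comp]; rfl
  rw [this, mem_ideal_span_monomial_image]
  simp only [mem_support_iff, Set.exists_range_iff]

open Classical in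
theorem quotientPiece_isInternal {n : ℕ} {m : Fin n → σ →₀ ℕ} {J : Ideal (MvPolynomial σ k)}
    (hJ : monomialIdeal m k = J) : DirectSum.IsInternal (quotientPiece J) := by
  refine isInternal_map polyPiece_isInternal (Ideal.Quotient.mk J).toAddMonoidHom
    Ideal.Quotient.mk_surjective fun γ f hf => ?_
  have hf : f ∈ J := Ideal.Quotient.eq_zero_iff_mem.1 hf
  refine Ideal.Quotient.eq_zero_iff_mem.2 ?_
  rw [← hJ, mem_monomialIdeal] at hf ⊢
  intro d hd
  rw [pieceProj_polyPiece, coeff_polyProj] at hd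
  exact hf d fun h => hd (by rw [h, ite_self])

end QuotientGrading

/-! ### Homogeneous parts of linear maps on the Taylor complex -/

section DegreePart

variable {k : Type u} [Field k] {σ : Type v} {n : ℕ} (m : Fin n → σ →₀ ℕ)
  {M : Type*} [AddCommGroup M] [Module (MvPolynomial σ k) M] {ℳ : (σ → ℤ) → AddSubgroup M}

theorem taylorX_map_eq {p : ℕ} (f : taylorX k σ n p →ₗ[MvPolynomial σ k] M) (γ : σ →₀ ℕ)
    {S : Finset (Fin n)} (hS : S.card = p) (c : k) :
    f ⟨taylorMonomial m γ S c, taylorMonomial_mem m γ hS c⟩ =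
      monomial (γ - lcmExp m S) c • f ⟨Finsupp.single S 1, Finsupp.single_mem_supported _ _ hS⟩ := by
  rw [← map_smul]
  congr 1
  exact Subtype.ext (by
    change Finsupp.single S _ = monomial (γ - lcmExp m S) c • Finsupp.single S (1 : MvPolynomial σ k)
    rw [Finsupp.smul_single, smul_eq_mul, mul_one])

/-- The linear map on a term of the Taylor complex with prescribed values on the generators. -/
def taylorLift (p : ℕ) (v : Finset (Fin n) → M) : taylorX k σ n p →ₗ[MvPolynomial σ k] M :=
  Finsupp.linearCombination _ v ∘ₗ (taylorX k σ n p).subtype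

theorem taylorLift_taylorMonomial {p : ℕ} (v : Finset (Fin n) → M) (γ : σ →₀ ℕ)
    {S : Finset (Fin n)} (hS : S.card = p) (c : k) :
    taylorLift p v ⟨taylorMonomial m γ S c, taylorMonomial_mem m γ hS c⟩ =
      monomial (γ - lcmExp m S) c • v S :=
  Finsupp.linearCombination_single _ _ _

open Classical in
/-- The part of degree `α` of a linear map on a term of the Taylor complex. -/
def taylorDegreePart (hM : DirectSum.IsInternal ℳ) (α : σ → ℤ) {p : ℕ}
    (f : taylorX k σ n p →ₗ[MvPolynomial σ k] M) : taylorX k σ n p →ₗ[MvPolynomial σ k] M :=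
  taylorLift p fun S => if hS : S.card = p then pieceProj hM (α + lcmDegree m S)
    (f ⟨Finsupp.single S 1, Finsupp.single_mem_supported _ _ hS⟩) else 0

theorem expDegree_tsub {d e : σ →₀ ℕ} (h : e ≤ d) :
    expDegree (d - e) = expDegree d - expDegree e := by
  conv_rhs => rw [← tsub_add_cancel_of_le h, expDegree_add, add_sub_cancel_right]

-- The values are projected on generators only. This suffices because multiplication by a monomial
-- shifts all degrees equally and so commutes with the projections.
open Classical in
theorem taylorDegreePart_apply (hM : DirectSum.IsInternal ℳ)
    (hsmul : ∀ (β γ : σ → ℤ) (a : MvPolynomial σ k) (x : M),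
      a ∈ polyPiece k β → x ∈ ℳ γ → a • x ∈ ℳ (β + γ)) (α : σ → ℤ) {p : ℕ}
    (f : taylorX k σ n p →ₗ[MvPolynomial σ k] M) {γ : σ → ℤ} {x : taylorX k σ n p}
    (hx : x ∈ taylorPiece m k p γ) :
    taylorDegreePart m hM α f x = pieceProj hM (α + γ) (f x) := by
  refine taylorPiece_induction m (P := fun x => taylorDegreePart m hM α f x =
    pieceProj hM (α + γ) (f x)) (by simp only [map_zero]) ?_ ?_ hx
  · intro x y hx hy
    simp only [map_add, hx, hy]
  · rintro d S hS c rfl hle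
    rw [taylorDegreePart, taylorLift_taylorMonomial m _ _ hS, dif_pos hS, taylorX_map_eq m _ _ hS]
    have ha := monomial_mem_polyPiece (d - lcmExp m S) c
    have := map_pieceProj hM hM (DistribSMul.toAddMonoidHom M (monomial (d - lcmExp m S) c))
      (expDegree (d - lcmExp m S) + ·) (add_right_injective _) (fun γ x hx => hsmul _ _ _ _ ha hx)
      (α + lcmDegree m S) (f ⟨Finsupp.single S 1, Finsupp.single_mem_supported _ _ hS⟩)
    refine this.trans ?_
    rw [expDegree_tsub hle, lcmDegree, show expDegree d - expDegree (lcmExp m S) +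
      (α + expDegree (lcmExp m S)) = α + expDegree d by abel]
    rfl

theorem taylorX_hom_ext {p : ℕ} {f g : taylorX k σ n p →ₗ[MvPolynomial σ k] M}
    (h : ∀ γ, ∀ x ∈ taylorPiece m k p γ, f x = g x) : f = g := by
  ext1 x
  have hx : x ∈ ⨆ γ, taylorPiece m k p γ := iSup_taylorPiece (k := k) m p ▸ AddSubgroup.mem_top x
  induction hx using AddSubgroup.iSup_induction' with
  | hp γ x hx => exact h γ x hx
  | h1 => simp only [map_zero]
  | hadd x y _ _ hx hy => rw [map_add, map_add, hx, hy]

end DegreePart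

/-! ### Degree-preserving lifts to graded resolutions -/

section GradedLift

variable {k : Type u} [Field k] {σ : Type v} {n n' : ℕ} {m : Fin n → σ →₀ ℕ}
  {m' : Fin n' → σ →₀ ℕ} {J J' : Ideal (MvPolynomial σ k)}

/-- The projection `A / J' → A / J`. -/
abbrev quotientMap (h : J' ≤ J) : ModuleCat.of (MvPolynomial σ k) (MvPolynomial σ k ⧸ J') ⟶
    ModuleCat.of (MvPolynomial σ k) (MvPolynomial σ k ⧸ J) :=
  ModuleCat.ofHom (Ideal.Quotient.factorₐ (MvPolynomial σ k) h).toLinearMap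

open Classical in
/-- The projection between quotients by monomial ideals lifts to a degree-preserving chain map from
the Taylor resolution to any graded resolution. -/
theorem exists_gradedLift (hJ : monomialIdeal m k = J) (hJ' : monomialIdeal m' k = J')
    (h : J' ≤ J) (F : GradedResolution (ModuleCat.of (MvPolynomial σ k) (MvPolynomial σ k ⧸ J))
      (quotientPiece J)) :
    ∃ g : (taylorResolution k m' hJ').complex ⟶ F.res.complex,
      g.f 0 ≫ F.res.π.f 0 = (taylorResolution k m' hJ').π.f 0 ≫ quotientMap h ∧
      ∀ (p : ℕ) (β : σ → ℤ) (x : taylorX k σ n' p), x ∈ taylorPiece m' k p β →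
        (g.f p).hom x ∈ F.piece p β := by
  let T := taylorGradedResolution m' hJ'
  -- Projectivity gives some lift, with no control of degrees. Its part of degree zero is again a
  -- lift, since differentials and augmentations preserve degrees and thus commute with the
  -- projections.
  let g₀ := ProjectiveResolution.lift (quotientMap h) T.res F.res
  let g : ∀ p, taylorX k σ n' p →ₗ[MvPolynomial σ k] F.res.complex.X p := fun p =>
    taylorDegreePart m' (F.isInternal p) 0 (g₀.f p).hom
  have hg : ∀ p γ, ∀ x ∈ taylorPiece m' k p γ,
      g p x = pieceProj (F.isInternal p) γ ((g₀.f p).hom x) := by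
    intro p γ x hx
    have := taylorDegreePart_apply m' (F.isInternal p) (F.smul_mem p) 0 (g₀.f p).hom hx
    rwa [zero_add] at this
  refine ⟨HomologicalComplex.Hom.mk (fun p => ModuleCat.ofHom (g p)) ?_, ?_, ?_⟩
  · rintro _ p rfl
    refine ModuleCat.hom_ext (taylorX_hom_ext m' fun γ x hx => ?_)
    have hd := T.d_mem p γ x hx
    change (F.res.complex.d (p + 1) p).hom (g (p + 1) x) = g p ((T.res.complex.d (p + 1) p).hom x)
    rw [hg _ _ _ hx, hg _ _ _ hd]
    refine (map_pieceProj (F.isInternal (p + 1)) (F.isInternal p)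
      (F.res.complex.d (p + 1) p).hom.toAddMonoidHom id Function.injective_id
      (F.d_mem p) γ _).trans (congrArg _ ?_)
    exact congr($(g₀.comm (p + 1) p).hom x)
  · refine ModuleCat.hom_ext (taylorX_hom_ext m' fun γ x hx => ?_)
    change (F.res.π.f 0).hom (g 0 x) = (T.res.π.f 0 ≫ quotientMap h).hom x
    rw [hg _ _ _ hx]
    have hmem : (T.res.π.f 0 ≫ quotientMap h).hom x ∈ quotientPiece J γ := by
      obtain ⟨a, ha, hax⟩ := T.augmentation_mem γ x hx
      exact ⟨a, ha, congrArg (quotientMap h).hom hax⟩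
    refine (map_pieceProj (F.isInternal 0) (quotientPiece_isInternal hJ)
      (F.res.π.f 0 ≫ (HomologicalComplex.singleObjXSelf _ 0 _).hom).hom.toAddMonoidHom id
      Function.injective_id F.augmentation_mem γ _).trans ?_
    have hcomm : (g₀.f 0 ≫ F.res.π.f 0).hom x = (T.res.π.f 0 ≫ quotientMap h).hom x := by
      rw [ProjectiveResolution.lift_commutes_zero]
      rfl
    refine Eq.trans (congrArg _ hcomm) (pieceProj_of_mem _ hmem)
  · intro p β x hx
    change g p x ∈ _
    rw [hg _ _ _ hx]
    exact pieceProj_mem _ _ _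

end GradedLift

/-! ### Graded pieces of Ext through the Taylor resolution -/

section ExtPiece

variable {k : Type u} [Field k] {σ : Type v} {n n' : ℕ} {m : Fin n → σ →₀ ℕ}
  {m' : Fin n' → σ →₀ ℕ} {J J' : Ideal (MvPolynomial σ k)}
  {M : ModuleCat.{max u v} (MvPolynomial σ k)} {ℳ : (σ → ℤ) → AddSubgroup M}

/-- The module `M` with pieces `ℳ` is graded over the finely graded polynomial ring. -/
def GradedSMul (M : ModuleCat.{max u v} (MvPolynomial σ k)) (ℳ : (σ → ℤ) → AddSubgroup M) : Prop :=
  ∀ (β γ : σ → ℤ) (a : MvPolynomial σ k) (x : M),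
    a ∈ polyPiece k β → x ∈ ℳ γ → a • x ∈ ℳ (β + γ)

theorem C_mem_polyPiece (c : k) : (C c : MvPolynomial σ k) ∈ polyPiece k (0 : σ → ℤ) := by
  rw [← expDegree_zero]
  exact monomial_mem_polyPiece 0 c

/-- A linear map from a term of the Taylor complex to `M` is homogeneous of degree `α`. -/
def TaylorHomogeneous (m : Fin n → σ →₀ ℕ) (ℳ : (σ → ℤ) → AddSubgroup M) (α : σ → ℤ) {p : ℕ}
    (f : taylorX k σ n p →ₗ[MvPolynomial σ k] M) : Prop :=
  ∀ β, ∀ x ∈ taylorPiece m k p β, f x ∈ ℳ (α + β)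

/-- A homogeneous cocycle on any graded resolution pulls back, along a degree-preserving lift of the
identity, to a homogeneous cocycle on the Taylor resolution. Those form a subspace, so the span in
`extPiece` adds nothing. -/
theorem mem_extPiece_iff (hsmul : GradedSMul M ℳ) (hJ : monomialIdeal m k = J)
    {i : ℕ} {α : σ → ℤ} {e : ExtMod i (ModuleCat.of (MvPolynomial σ k) (MvPolynomial σ k ⧸ J)) M} :
    e ∈ extPiece i _ M (quotientPiece J) ℳ α ↔
      ∃ f : (taylorResolution k m hJ).complex.X i ⟶ M,
        RepresentsExt (taylorResolution k m hJ) f e ∧ TaylorHomogeneous m ℳ α f.hom := by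
  constructor
  · intro he
    refine Submodule.span_induction ?_ ?_ ?_ ?_ he
    · rintro e ⟨F, z, f, hz, hf, rfl⟩
      obtain ⟨g, hg, hgp⟩ := exists_gradedLift hJ hJ le_rfl F
      have hid : quotientMap (le_refl J) = 𝟙 _ := by
        refine ModuleCat.hom_ext (LinearMap.ext fun q => ?_)
        obtain ⟨a, rfl⟩ := Ideal.Quotient.mk_surjective q
        rfl
      have h := RepresentsExt.map ⟨z, hz, rfl⟩ (taylorResolution k m hJ) _ g hg
      rw [hid] at h
      refine ⟨g.f i ≫ f, ?_, fun β x hx => hf β _ (hgp i β x hx)⟩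
      rwa [op_id, CategoryTheory.Functor.map_id] at h
    · exact ⟨0, RepresentsExt.zero, fun β x _ => zero_mem _⟩
    · rintro e e' - - ⟨f, hf, hfh⟩ ⟨f', hf', hfh'⟩
      exact ⟨f + f', hf.add hf', fun β x hx => add_mem (hfh β x hx) (hfh' β x hx)⟩
    · rintro c e - ⟨f, hf, hfh⟩
      refine ⟨(C c : MvPolynomial σ k) • f, ?_, fun β x hx => ?_⟩
      · exact hf.smul (C c)
      · have := hsmul _ _ _ _ (C_mem_polyPiece c) (hfh β x hx)
        rwa [zero_add] at this
  · rintro ⟨f, ⟨z, hz, rfl⟩, hfh⟩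
    exact Submodule.subset_span ⟨taylorGradedResolution m hJ, z, f, hz, hfh, rfl⟩

theorem ext_map_mem_extPiece (hsmul : GradedSMul M ℳ) (hJ : monomialIdeal m k = J)
    (hJ' : monomialIdeal m' k = J') (h : J' ≤ J) {i : ℕ} {α : σ → ℤ}
    {e : ExtMod i (ModuleCat.of (MvPolynomial σ k) (MvPolynomial σ k ⧸ J)) M}
    (he : e ∈ extPiece i _ M (quotientPiece J) ℳ α) :
    (((Ext (MvPolynomial σ k) (ModuleCat.{max u v} (MvPolynomial σ k)) i).map
      (quotientMap h).op).app M).hom e ∈ extPiece i _ M (quotientPiece J') ℳ α := by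
  rw [mem_extPiece_iff hsmul hJ] at he
  rw [mem_extPiece_iff hsmul hJ']
  obtain ⟨f, hf, hfh⟩ := he
  obtain ⟨g, hg, hgp⟩ := exists_gradedLift hJ hJ' h (taylorGradedResolution m hJ)
  exact ⟨g.f i ≫ f, hf.map (taylorResolution k m' hJ') _ g hg,
    fun β x hx => hfh β _ (hgp i β x hx)⟩

theorem prev_up_eq (i : ℕ) : (i = 0 ∧ (ComplexShape.up ℕ).prev i = 0) ∨
    (ComplexShape.up ℕ).prev i + 1 = i := by
  cases i with
  | zero => exact Or.inl ⟨rfl, by simp⟩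
  | succ i => exact Or.inr (by simp)

theorem taylorComplex_d_mem_piece (i : ℕ) {γ : σ → ℤ} {x : taylorX k σ n i}
    (hx : x ∈ taylorPiece m k i γ) :
    (((taylorComplex k m).d i ((ComplexShape.up ℕ).prev i)).hom x :
      taylorX k σ n ((ComplexShape.up ℕ).prev i)) ∈ taylorPiece m k _ γ := by
  obtain ⟨rfl, h⟩ | h := prev_up_eq i
  · rw [h, (taylorComplex k m).shape 0 0 (by simp)]
    exact zero_mem _
  · generalize (ComplexShape.up ℕ).prev i = j at h
    subst h
    exact (taylorGradedResolution m rfl).d_mem j γ x hx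

-- If `f` has degree `α`, then the part of degree `α` of any cochain with coboundary `f` still has
-- coboundary `f`.
open Classical in
theorem exists_homogeneous_coboundary (hM : DirectSum.IsInternal ℳ) (hsmul : GradedSMul M ℳ)
    (hJ : monomialIdeal m k = J) {i : ℕ} {α : σ → ℤ}
    {f : (taylorResolution k m hJ).complex.X i ⟶ M}
    (hf : TaylorHomogeneous m ℳ α f.hom) (h : RepresentsExt (taylorResolution k m hJ) f 0) :
    ∃ b : (taylorComplex k m).X ((ComplexShape.up ℕ).prev i) ⟶ M,
      TaylorHomogeneous m ℳ α b.hom ∧ f = (taylorComplex k m).d i _ ≫ b := by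
  obtain ⟨b, rfl⟩ := (RepresentsExt.iff_coboundary rfl).1 h
  have happ : ∀ γ, ∀ x ∈ taylorPiece m k _ γ, taylorDegreePart m hM α b.hom x =
    pieceProj hM (α + γ) (b.hom x) := fun γ x hx => taylorDegreePart_apply m hM hsmul α b.hom hx
  refine ⟨ModuleCat.ofHom (taylorDegreePart m hM α b.hom), ?_, ?_⟩
  · intro γ x hx
    change taylorDegreePart m hM α b.hom x ∈ _
    rw [happ γ x hx]
    exact pieceProj_mem _ _ _
  · refine ModuleCat.hom_ext (taylorX_hom_ext m fun γ x hx => ?_)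
    have h1 := hf γ x hx
    exact (pieceProj_of_mem hM h1).symm.trans (happ γ _ (taylorComplex_d_mem_piece i hx)).symm

end ExtPiece

/-! ### Comparison of two Taylor complexes and squarefree modules -/

section Comparison

variable {k : Type u} [Field k] {σ : Type v} {n : ℕ} {m m' : Fin n → σ →₀ ℕ}

theorem lcmExp_le_lcmExp (hm : ∀ j, m j ≤ m' j) (S : Finset (Fin n)) :
    lcmExp m S ≤ lcmExp m' S := Finset.sup_mono_fun fun j _ => hm j

variable (k m m') in
/-- The comparison map between the Taylor complexes of two families of monomials, on the direct
sums of the terms. -/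
def taylorComparison : (Finset (Fin n) →₀ MvPolynomial σ k) →ₗ[MvPolynomial σ k]
    (Finset (Fin n) →₀ MvPolynomial σ k) :=
  Finsupp.linearCombination _ fun S => taylorMonomial m (lcmExp m' S) S 1

theorem taylorComparison_taylorMonomial (hm : ∀ j, m j ≤ m' j) {γ : σ →₀ ℕ}
    {S : Finset (Fin n)} (h : lcmExp m' S ≤ γ) (c : k) :
    taylorComparison k m m' (taylorMonomial m' γ S c) = taylorMonomial m γ S c := by
  rw [taylorComparison, taylorMonomial, Finsupp.linearCombination_single, taylorMonomial,
    taylorMonomial, Finsupp.smul_single, smul_eq_mul, monomial_mul, mul_one,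
    tsub_add_tsub_cancel h (lcmExp_le_lcmExp hm S)]

theorem taylorComparison_mem (hm : ∀ j, m j ≤ m' j) {p : ℕ}
    {x : Finset (Fin n) →₀ MvPolynomial σ k} (hx : x ∈ taylorX k σ n p) :
    taylorComparison k m m' x ∈ taylorX k σ n p := by
  refine finsupp_poly_induction m' (p := fun x => taylorComparison k m m' x ∈ taylorX k σ n p)
    (·.card = p) (by simp) ?_ ?_ x (mem_taylorX.1 hx)
  · intro x y hx hy
    rw [map_add]; exact add_mem hx hy
  · intro S d c hS
    rw [taylorComparison_taylorMonomial hm le_add_self]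
    exact taylorMonomial_mem m _ hS _

/-- In a fixed degree both differentials are the same simplicial boundary, and the comparison is the
identity on faces and coefficients. -/
theorem taylorD_taylorComparison (hm : ∀ j, m j ≤ m' j)
    (x : Finset (Fin n) →₀ MvPolynomial σ k) :
    taylorD m k (taylorComparison k m m' x) = taylorComparison k m m' (taylorD m' k x) := by
  refine finsupp_poly_induction m' (p := fun x => taylorD m k (taylorComparison k m m' x) =
    taylorComparison k m m' (taylorD m' k x)) (fun _ => True) (by simp) ?_ ?_ x fun _ _ => trivial
  · intro x y hx hy
    simp only [map_add, hx, hy]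
  · intro S d c _
    have h : lcmExp m' S ≤ d + lcmExp m' S := le_add_self
    rw [taylorComparison_taylorMonomial hm h,
      taylorD_taylorMonomial m ((lcmExp_le_lcmExp hm S).trans h), taylorD_taylorMonomial m' h,
      map_sum]
    exact Finset.sum_congr rfl fun s _ => (taylorComparison_taylorMonomial hm
      ((lcmExp_mono m' (Finset.erase_subset _ _)).trans h) _).symm

/-- The comparison map between the terms of two Taylor complexes. -/
def taylorComparisonX (k : Type u) [Field k] (hm : ∀ j, m j ≤ m' j) (p : ℕ) :
    taylorX k σ n p →ₗ[MvPolynomial σ k] taylorX k σ n p :=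
  (taylorComparison k m m').restrict fun _ hx => taylorComparison_mem hm hx

/-- The comparison map between two Taylor complexes. -/
def taylorComparisonHom (k : Type u) [Field k] (hm : ∀ j, m j ≤ m' j) :
    taylorComplex k m' ⟶ taylorComplex k m where
  f p := ModuleCat.ofHom (taylorComparisonX k hm p)
  comm' := by
    rintro _ p rfl
    refine ModuleCat.hom_ext (LinearMap.ext fun x => Subtype.ext ?_)
    refine (taylorComplex_d k m p (taylorComparisonX k hm (p + 1) x)).trans ?_
    refine (taylorD_taylorComparison hm x.1).trans ?_
    exact congrArg (taylorComparison k m m') (taylorComplex_d k m' p x).symm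

theorem taylorComparisonX_mem_piece (hm : ∀ j, m j ≤ m' j) {p : ℕ} {γ : σ → ℤ}
    {x : taylorX k σ n p} (hx : x ∈ taylorPiece m' k p γ) :
    taylorComparisonX k hm p x ∈ taylorPiece m k p γ := by
  refine taylorPiece_induction m' (P := fun x => taylorComparisonX k hm p x ∈ taylorPiece m k p γ)
    ?_ ?_ ?_ hx
  · rw [map_zero]; exact zero_mem _
  · intro x y hx hy
    rw [map_add]; exact add_mem hx hy
  · rintro d S hS c rfl hle
    convert taylorMonomial_mem_piece m hS ((lcmExp_le_lcmExp hm S).trans hle) c using 1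
    exact Subtype.ext (taylorComparison_taylorMonomial hm hle c)

theorem taylorComparison_augmentation (hm : ∀ j, m j ≤ m' j) {J J' : Ideal (MvPolynomial σ k)}
    (hJ : monomialIdeal m k = J) (hJ' : monomialIdeal m' k = J') (h : J' ≤ J) :
    (taylorComparisonHom k hm).f 0 ≫ (taylorResolution k m hJ).π.f 0 =
      (taylorResolution k m' hJ').π.f 0 ≫ quotientMap h := by
  have h1 : (taylorResolution k m hJ).π.f 0 = ModuleCat.ofHom (taylorAugmentation k J) :=
    ChainComplex.toSingle₀Equiv_symm_apply_f_zero (C := taylorComplex k m) _ _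
  have h2 : (taylorResolution k m' hJ').π.f 0 = ModuleCat.ofHom (taylorAugmentation k J') :=
    ChainComplex.toSingle₀Equiv_symm_apply_f_zero (C := taylorComplex k m') _ _
  rw [h1, h2]
  refine ModuleCat.hom_ext (LinearMap.ext fun x => ?_)
  change Submodule.Quotient.mk (taylorComparison k m m' x.1 ∅) = Submodule.Quotient.mk (x.1 ∅)
  congr 1
  conv_lhs => rw [eq_single_empty k x.2, taylorComparison, Finsupp.linearCombination_single]
  simp [taylorMonomial, lcmExp]

variable {M : ModuleCat.{max u v} (MvPolynomial σ k)} {ℳ : (σ → ℤ) → AddSubgroup M}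

/-- Multiplication by monomials is bijective between the pieces of degree `γ` and `γ + d` if `γ`
is positive in the support of `d`: the module is squarefree. -/
structure IsSquarefree (M : ModuleCat.{max u v} (MvPolynomial σ k))
    (ℳ : (σ → ℤ) → AddSubgroup M) : Prop where
  isInternal : open Classical in DirectSum.IsInternal ℳ
  gradedSMul : GradedSMul M ℳ
  eq_zero : ∀ (d : σ →₀ ℕ) (γ : σ → ℤ), (∀ s, d s ≠ 0 → 1 ≤ γ s) → ∀ x ∈ ℳ γ,
    monomial d (1 : k) • x = 0 → x = 0
  exists_smul : ∀ (d : σ →₀ ℕ) (γ : σ → ℤ), (∀ s, d s ≠ 0 → 1 ≤ γ s) →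
    ∀ y ∈ ℳ (γ + expDegree d), ∃ x ∈ ℳ γ, monomial d (1 : k) • x = y

-- The comparison multiplies the generator `S` by the monomial of exponent `lcmExp m' S - lcmExp m
-- S`. The condition `hα` is what squarefreeness needs to invert this monomial on the piece where a
-- cochain of degree `α` takes its value at `S`.
variable {α : σ → ℤ} (hα : ∀ S s, (lcmExp m' S - lcmExp m S) s ≠ 0 → 1 ≤ (α + lcmDegree m S) s)
  (hM : IsSquarefree M ℳ) (hm : ∀ j, m j ≤ m' j)

theorem taylorComparisonX_apply {p : ℕ} {γ : σ →₀ ℕ} {S : Finset (Fin n)} (hS : S.card = p)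
    (hle : lcmExp m' S ≤ γ) (c : k) :
    taylorComparisonX k hm p ⟨taylorMonomial m' γ S c, taylorMonomial_mem m' γ hS c⟩ =
      ⟨taylorMonomial m γ S c, taylorMonomial_mem m γ hS c⟩ :=
  Subtype.ext (taylorComparison_taylorMonomial hm hle c)

theorem single_mem_taylorPiece {p : ℕ} {S : Finset (Fin n)} (hS : S.card = p) :
    (⟨Finsupp.single S 1, Finsupp.single_mem_supported _ _ hS⟩ : taylorX k σ n p) ∈
      taylorPiece m k p (lcmDegree m S) := by
  have e : (⟨Finsupp.single S 1, Finsupp.single_mem_supported _ _ hS⟩ : taylorX k σ n p) =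
      ⟨taylorMonomial m (lcmExp m S) S 1, taylorMonomial_mem m _ hS 1⟩ := by
    refine Subtype.ext ?_
    change _ = taylorMonomial m (lcmExp m S) S 1
    rw [taylorMonomial, tsub_self]
    rfl
  rw [e]
  exact taylorMonomial_mem_piece m hS le_rfl 1

-- Injectivity on cochains of degree `α`: composing with the comparison multiplies the value at each
-- generator by a monomial that is injective on the relevant piece.
include hα hM in
theorem eq_zero_of_comp_comparison {p : ℕ} {f : taylorX k σ n p →ₗ[MvPolynomial σ k] M}
    (hf : TaylorHomogeneous m ℳ α f) (h : f ∘ₗ taylorComparisonX k hm p = 0) : f = 0 := by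
  have hgen : ∀ (S : Finset (Fin n)) (hS : S.card = p),
      f ⟨Finsupp.single S 1, Finsupp.single_mem_supported _ _ hS⟩ = 0 := by
    intro S hS
    refine hM.eq_zero (lcmExp m' S - lcmExp m S) _ (hα S) _
      (hf _ _ (single_mem_taylorPiece hS)) ?_
    rw [← taylorX_map_eq m f (lcmExp m' S) hS, ← taylorComparisonX_apply hm hS le_rfl]
    exact LinearMap.congr_fun h _
  refine taylorX_hom_ext m fun γ x hx => ?_
  refine taylorPiece_induction m (P := fun x => f x = 0) (map_zero f) ?_ ?_ hx
  · intro x y hx hy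
    rw [map_add, hx, hy, add_zero]
  · rintro d S hS c - -
    rw [taylorX_map_eq m f d hS, hgen S hS, smul_zero]

-- Surjectivity on cochains of degree `α`: the value at each generator can be divided by that
-- monomial, and the term is free on the generators.
include hα hM in
theorem exists_comp_comparison {p : ℕ} {f' : taylorX k σ n p →ₗ[MvPolynomial σ k] M}
    (hf' : TaylorHomogeneous m' ℳ α f') :
    ∃ f : taylorX k σ n p →ₗ[MvPolynomial σ k] M,
      TaylorHomogeneous m ℳ α f ∧ f ∘ₗ taylorComparisonX k hm p = f' := by
  -- The cardinality is a premise of the inner equation, so that `choose` gives values on all sets;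
  -- those of the wrong size receive `0`.
  have hgen : ∀ S : Finset (Fin n), ∃ y ∈ ℳ (α + lcmDegree m S), ∀ hS : S.card = p,
      monomial (lcmExp m' S - lcmExp m S) (1 : k) • y =
        f' ⟨Finsupp.single S 1, Finsupp.single_mem_supported _ _ hS⟩ := by
    intro S
    by_cases hS : S.card = p
    · obtain ⟨y, hy, hyf⟩ := hM.exists_smul (lcmExp m' S - lcmExp m S) _ (hα S)
        (f' ⟨Finsupp.single S 1, Finsupp.single_mem_supported _ _ hS⟩) (by
          have := hf' _ _ (single_mem_taylorPiece hS)
          rwa [expDegree_tsub (lcmExp_le_lcmExp hm S), lcmDegree, add_assoc,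
            add_sub_cancel])
      exact ⟨y, hy, fun _ => hyf⟩
    · exact ⟨0, zero_mem _, fun h => absurd h hS⟩
  choose v hv hvf using hgen
  refine ⟨taylorLift p v, ?_, ?_⟩
  · intro β x hx
    refine taylorPiece_induction m (P := fun x => taylorLift p v x ∈ ℳ (α + β)) ?_ ?_ ?_ hx
    · rw [map_zero]; exact zero_mem _
    · intro x y hx hy
      rw [map_add]; exact add_mem hx hy
    · rintro d S hS c rfl hle
      rw [taylorLift_taylorMonomial m v d hS]
      have := hM.gradedSMul _ _ _ _ (monomial_mem_polyPiece (d - lcmExp m S) c) (hv S)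
      rwa [expDegree_tsub hle, lcmDegree, show expDegree d - expDegree (lcmExp m S) +
        (α + expDegree (lcmExp m S)) = α + expDegree d by abel] at this
  · refine taylorX_hom_ext m' fun γ x hx => ?_
    refine taylorPiece_induction m' (P := fun x => (taylorLift p v ∘ₗ taylorComparisonX k hm p) x =
      f' x) (by simp only [map_zero]) ?_ ?_ hx
    · intro x y hx hy
      rw [map_add, map_add, hx, hy]
    · rintro d S hS c rfl hle
      rw [LinearMap.comp_apply, taylorComparisonX_apply hm hS hle,
        taylorLift_taylorMonomial m v d hS, taylorX_map_eq m' f' d hS, ← hvf S hS, smul_smul,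
        monomial_mul, mul_one, tsub_add_tsub_cancel hle (lcmExp_le_lcmExp hm S)]

variable {J J' : Ideal (MvPolynomial σ k)} (hJ : monomialIdeal m k = J)
  (hJ' : monomialIdeal m' k = J') (h : J' ≤ J) {i : ℕ}

-- Lift `b'` to a cochain `b` of degree `α`. The difference of `f` and the coboundary of `b` is
-- killed by the comparison, hence is zero by injectivity.
include hα hM in
theorem exists_coboundary_of_comp_comparison
    {f : (taylorComplex k m).X i ⟶ M} (hf : TaylorHomogeneous m ℳ α f.hom)
    {b' : (taylorComplex k m').X ((ComplexShape.up ℕ).prev i) ⟶ M}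
    (hb' : TaylorHomogeneous m' ℳ α b'.hom)
    (hfb' : (taylorComparisonHom k hm).f i ≫ f = (taylorComplex k m').d i _ ≫ b') :
    ∃ b : (taylorComplex k m).X ((ComplexShape.up ℕ).prev i) ⟶ M,
      f = (taylorComplex k m).d i _ ≫ b := by
  obtain ⟨b, hb, hbb'⟩ := exists_comp_comparison hα hM hm hb'
  let B : (taylorComplex k m).X ((ComplexShape.up ℕ).prev i) ⟶ M := ModuleCat.ofHom b
  have hB : (taylorComparisonHom k hm).f _ ≫ B = b' := ModuleCat.hom_ext hbb'
  refine ⟨B, sub_eq_zero.1 (ModuleCat.hom_ext ?_)⟩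
  refine eq_zero_of_comp_comparison (p := i) hα hM hm (fun β x hx => ?_) ?_
  · exact sub_mem (hf β x hx) (hb β _ (taylorComplex_d_mem_piece i hx))
  · have h0 : (taylorComparisonHom k hm).f i ≫ (f - (taylorComplex k m).d i _ ≫ B) = 0 := by
      rw [Preadditive.comp_sub, hfb', ← Category.assoc, (taylorComparisonHom k hm).comm,
        Category.assoc, hB, sub_self]
    exact congrArg ModuleCat.Hom.hom h0

include hα hM hm hJ hJ' in
theorem eq_zero_of_ext_map_eq_zero
    {e : ExtMod i (ModuleCat.of (MvPolynomial σ k) (MvPolynomial σ k ⧸ J)) M}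
    (he : e ∈ extPiece i _ M (quotientPiece J) ℳ α)
    (he0 : (((Ext (MvPolynomial σ k) (ModuleCat.{max u v} (MvPolynomial σ k)) i).map
      (quotientMap h).op).app M).hom e = 0) : e = 0 := by
  obtain ⟨f, hf, hfh⟩ := (mem_extPiece_iff hM.gradedSMul hJ).1 he
  have hmap := hf.map (taylorResolution k m' hJ') (quotientMap h) (taylorComparisonHom k hm)
    (taylorComparison_augmentation hm hJ hJ' h)
  rw [he0] at hmap
  have hhom : TaylorHomogeneous m' ℳ α
      (((taylorComparisonHom k hm).f i ≫ f).hom : taylorX k σ n i →ₗ[MvPolynomial σ k] M) :=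
    fun β x hx => hfh β _ (taylorComparisonX_mem_piece hm hx)
  obtain ⟨b', hb', hfb'⟩ := exists_homogeneous_coboundary
    (f := (taylorComparisonHom k hm).f i ≫ f) hM.isInternal hM.gradedSMul hJ' hhom hmap
  obtain ⟨b, hfb⟩ := exists_coboundary_of_comp_comparison hα hM hm hfh hb' hfb'
  exact hf.unique ((RepresentsExt.iff_coboundary rfl).2 ⟨b, hfb⟩)

include hα hM hm hJ hJ' in
theorem exists_ext_map_eq
    {e' : ExtMod i (ModuleCat.of (MvPolynomial σ k) (MvPolynomial σ k ⧸ J')) M}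
    (he' : e' ∈ extPiece i _ M (quotientPiece J') ℳ α) :
    ∃ e ∈ extPiece i (ModuleCat.of (MvPolynomial σ k) (MvPolynomial σ k ⧸ J)) M
      (quotientPiece J) ℳ α,
      (((Ext (MvPolynomial σ k) (ModuleCat.{max u v} (MvPolynomial σ k)) i).map
        (quotientMap h).op).app M).hom e = e' := by
  obtain ⟨f', hf', hfh'⟩ := (mem_extPiece_iff hM.gradedSMul hJ').1 he'
  obtain ⟨f, hfh, hff'⟩ := exists_comp_comparison hα hM hm hfh'
  -- The lifted cochain is a cocycle by injectivity one step higher: after the comparison its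
  -- coboundary becomes that of `f'`.
  have hd : (taylorResolution k m hJ).complex.d (i + 1) i ≫ (ModuleCat.ofHom f :
      (taylorComplex k m).X i ⟶ M) = 0 := by
    refine ModuleCat.hom_ext (eq_zero_of_comp_comparison hα hM hm (fun β x hx =>
      hfh β _ ((taylorGradedResolution m hJ).d_mem i β x hx)) ?_)
    refine LinearMap.ext fun x => ?_
    have h2 := congr($((taylorComparisonHom k hm).comm (i + 1) i).hom x)
    refine (congrArg f h2).trans ((LinearMap.congr_fun hff' _).trans ?_)
    exact congr($(hf'.cocycle (i + 1)).hom x)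
  obtain ⟨e, he⟩ := RepresentsExt.exists_of_cocycle hd
  refine ⟨e, (mem_extPiece_iff hM.gradedSMul hJ).2 ⟨_, he, hfh⟩, ?_⟩
  have hmap := he.map (taylorResolution k m' hJ') (quotientMap h) (taylorComparisonHom k hm)
    (taylorComparison_augmentation hm hJ hJ' h)
  refine hmap.unique ?_
  convert hf' using 1
  exact ModuleCat.hom_ext hff'

end Comparison

/-! ### Powers of the irrelevant ideal and ideals of powers of variables -/

section MonomialIdeals

variable {k : Type u} [Field k] {σ : Type v}

/-- The exponents of the `ℓ`-th powers of the variables. -/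
def powerExp {n : ℕ} (eq : Fin n ≃ σ) (ℓ : ℕ) (j : Fin n) : σ →₀ ℕ := Finsupp.single (eq j) ℓ

theorem monomialIdeal_powerExp {n : ℕ} (eq : Fin n ≃ σ) (ℓ : ℕ) :
    monomialIdeal (powerExp eq ℓ) k = powerIdeal k σ ℓ := by
  rw [monomialIdeal, powerIdeal, ← eq.surjective.range_comp]
  simp only [Function.comp_def, X_pow_eq_monomial, powerExp]

theorem powerIdeal_one : powerIdeal k σ 1 = irrelevantIdeal k σ := by
  simp only [powerIdeal, irrelevantIdeal, pow_one]

/-- The products may repeat and need not generate minimally. The Taylor complex allows this, so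
powers of the irrelevant ideal also have Taylor resolutions. -/
theorem monomialIdeal_mul {n n' : ℕ} (m : Fin n → σ →₀ ℕ) (m' : Fin n' → σ →₀ ℕ) :
    monomialIdeal (fun j : Fin (n * n') => m (finProdFinEquiv.symm j).1 +
      m' (finProdFinEquiv.symm j).2) k = monomialIdeal m k * monomialIdeal m' k := by
  rw [monomialIdeal, monomialIdeal, monomialIdeal, Ideal.span_mul_span']
  congr 1
  ext f
  simp only [Set.mem_range, Set.mem_mul, exists_exists_eq_and, monomial_mul, mul_one]
  constructor
  · rintro ⟨j, rfl⟩
    exact ⟨_, _, rfl⟩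
  · rintro ⟨a, b, rfl⟩
    exact ⟨finProdFinEquiv (a, b), by simp⟩

theorem exists_monomialIdeal_eq_pow [Finite σ] (t : ℕ) :
    ∃ (n : ℕ) (m : Fin n → σ →₀ ℕ), monomialIdeal m k = irrelevantIdeal k σ ^ t := by
  induction t with
  | zero =>
    refine ⟨1, fun _ => 0, ?_⟩
    rw [pow_zero, Ideal.one_eq_top, Ideal.eq_top_iff_one]
    exact Ideal.subset_span ⟨0, rfl⟩
  | succ t ih =>
    obtain ⟨n, m, h⟩ := ih
    obtain ⟨n', ⟨eq⟩⟩ := Finite.exists_equiv_fin σ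
    exact ⟨_, _, by rw [pow_succ, ← h, ← powerIdeal_one, ← monomialIdeal_powerExp eq.symm,
      ← monomialIdeal_mul]⟩

theorem powerIdeal_le_pow {ℓ t : ℕ} (h : t ≤ ℓ) : powerIdeal k σ ℓ ≤ irrelevantIdeal k σ ^ t := by
  rw [powerIdeal, Ideal.span_le]
  rintro _ ⟨s, rfl⟩
  exact Ideal.pow_le_pow_right h (Ideal.pow_mem_pow (Ideal.subset_span (Set.mem_range_self s)) ℓ)

theorem powerIdeal_antitone {ℓ ℓ' : ℕ} (h : ℓ ≤ ℓ') : powerIdeal k σ ℓ' ≤ powerIdeal k σ ℓ := by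
  rw [powerIdeal, Ideal.span_le]
  rintro _ ⟨s, rfl⟩
  exact Ideal.mem_of_dvd _ (pow_dvd_pow _ h) (Ideal.subset_span (Set.mem_range_self s))

theorem powerExp_mono {n : ℕ} (eq : Fin n ≃ σ) {ℓ ℓ' : ℕ} (h : ℓ ≤ ℓ') (j : Fin n) :
    powerExp eq ℓ j ≤ powerExp eq ℓ' j := Finsupp.single_mono h

theorem lcmExp_powerExp_apply {n : ℕ} (eq : Fin n ≃ σ) (ℓ : ℕ) (S : Finset (Fin n)) (s : σ) :
    lcmExp (powerExp eq ℓ) S s = if eq.symm s ∈ S then ℓ else 0 := by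
  classical
  rw [lcmExp]
  induction S using Finset.induction_on with
  | empty => simp [bot_eq_zero]
  | insert a S _ ih =>
    have h : eq.symm s = a ↔ eq a = s := by rw [Equiv.symm_apply_eq, eq_comm]
    rw [Finset.sup_insert, Finsupp.sup_apply, ih, powerExp, Finsupp.single_apply]
    simp only [Finset.mem_insert, h]
    by_cases h1 : eq a = s <;> by_cases h2 : eq.symm s ∈ S <;> simp [h1, h2]

/-- The bound on `α` enters here: a variable in the multiplier belongs to `S`, where the generator
has degree `ℓ`, and `α s + ℓ ≥ 1`. -/
theorem one_le_of_lcmExp_tsub_ne_zero {n : ℕ} (eq : Fin n ≃ σ) {ℓ ℓ' : ℕ} {α : σ → ℤ}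
    (hα : ∀ s, 1 - (ℓ : ℤ) ≤ α s) (S : Finset (Fin n)) (s : σ)
    (h : (lcmExp (powerExp eq ℓ') S - lcmExp (powerExp eq ℓ) S) s ≠ 0) :
    1 ≤ (α + lcmDegree (powerExp eq ℓ) S) s := by
  rw [Finsupp.tsub_apply, lcmExp_powerExp_apply, lcmExp_powerExp_apply] at h
  have : eq.symm s ∈ S := by
    by_contra h'
    simp [h'] at h
  rw [Pi.add_apply, lcmDegree, expDegree, lcmExp_powerExp_apply, if_pos this]
  linarith [hα s]

end MonomialIdeals

/-! ### Passage to the direct limit -/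

section LocalCohomology

theorem exists_equiv_of_map_eq {R V W : Type*} [Ring R] [AddCommGroup V] [AddCommGroup W]
    [Module R V] [Module R W] {φ : V →ₗ[R] W} {p : Submodule R V} {q : Submodule R W}
    (himg : p.map φ = q) (hinj : ∀ x ∈ p, φ x = 0 → x = 0) :
    ∃ e : p ≃ₗ[R] q, ∀ x, (e x).1 = φ x.1 := by
  subst himg
  refine ⟨LinearEquiv.ofBijective (φ.submoduleMap p) ⟨?_, φ.submoduleMap_surjective p⟩,
    fun x => rfl⟩
  rw [injective_iff_map_eq_zero]
  rintro ⟨x, hx⟩ h0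
  exact Subtype.ext (hinj x hx (congrArg Subtype.val h0))

variable {k : Type u} [Field k] {σ : Type v} {M : ModuleCat.{max u v} (MvPolynomial σ k)}

/-- The map on `Ext^i(-, M)` induced by a projection `A / J' → A / J`. -/
abbrev extQuotientMap {J J' : Ideal (MvPolynomial σ k)} (h : J' ≤ J) (i : ℕ)
    (M : ModuleCat.{max u v} (MvPolynomial σ k)) :
    ExtMod i (ModuleCat.of (MvPolynomial σ k) (MvPolynomial σ k ⧸ J)) M ⟶
      ExtMod i (ModuleCat.of (MvPolynomial σ k) (MvPolynomial σ k ⧸ J')) M :=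
  ((Ext (MvPolynomial σ k) (ModuleCat.{max u v} (MvPolynomial σ k)) i).map
    (quotientMap h).op).app M

theorem extQuotientMap_comp {J J' J'' : Ideal (MvPolynomial σ k)} (h : J' ≤ J) (h' : J'' ≤ J')
    (i : ℕ) : extQuotientMap h i M ≫ extQuotientMap h' i M = extQuotientMap (h'.trans h) i M := by
  have : quotientMap h' ≫ quotientMap h = quotientMap (h'.trans h) := by
    refine ModuleCat.hom_ext (LinearMap.ext fun q => ?_)
    obtain ⟨a, rfl⟩ := Ideal.Quotient.mk_surjective q
    rfl
  rw [extQuotientMap, extQuotientMap, extQuotientMap, ← this, op_comp,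
    CategoryTheory.Functor.map_comp, NatTrans.comp_app]

variable (I : Ideal (MvPolynomial σ k)) (i : ℕ)

theorem diagram_map_app {t t' : ℕ} (h : t ≤ t') :
    ((localCohomology.diagram (localCohomology.idealPowersDiagram I) i).map
      (homOfLE h).op.op).app M = extQuotientMap (Ideal.pow_le_pow_right (I := I) h) i M := by
  have : (localCohomology.ringModIdeals (localCohomology.idealPowersDiagram I)).map (homOfLE h).op =
      quotientMap (Ideal.pow_le_pow_right (I := I) h) := by
    refine ModuleCat.hom_ext (LinearMap.ext fun q => ?_)
    obtain ⟨a, rfl⟩ := Ideal.Quotient.mk_surjective q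
    rfl
  change ((Ext _ _ i).map ((localCohomology.ringModIdeals
    (localCohomology.idealPowersDiagram I)).map (homOfLE h).op).op).app M = _
  rw [this]
  rfl

theorem extQuotientMap_toLocalCohomology {t t' : ℕ} (h : t ≤ t') :
    extQuotientMap (Ideal.pow_le_pow_right (I := I) h) i M ≫ toLocalCohomology I i t' M =
      toLocalCohomology I i t M := by
  rw [← diagram_map_app I i h]
  have := colimit.w (localCohomology.diagram (localCohomology.idealPowersDiagram I) i)
    (homOfLE h).op.op
  exact congr($(this).app M)

/-- The colimit of functors is computed pointwise and is filtered, so an element vanishing in it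
already vanishes at a finite stage. -/
theorem exists_of_toLocalCohomology_eq_zero {t : ℕ}
    {e : ExtMod i (ModuleCat.of _ (MvPolynomial σ k ⧸ I ^ t)) M}
    (he : (toLocalCohomology I i t M).hom e = 0) :
    ∃ t', ∃ h : t ≤ t', (extQuotientMap (Ideal.pow_le_pow_right (I := I) h) i M).hom e = 0 := by
  let D := localCohomology.diagram (localCohomology.idealPowersDiagram I) i
  have hc := isColimitOfPreserves ((evaluation _ (ModuleCat.{max u v} (MvPolynomial σ k))).obj M)
    (colimit.isColimit D)
  have hc0 : (((evaluation _ (ModuleCat.{max u v} (MvPolynomial σ k))).obj M).mapCocone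
    (colimit.cocone D)).ι.app (op (op t)) e =
    (((evaluation _ (ModuleCat.{max u v} (MvPolynomial σ k))).obj M).mapCocone
    (colimit.cocone D)).ι.app (op (op t)) 0 := he.trans (map_zero _).symm
  have : PreservesFilteredColimitsOfSize.{0, 0} (forget (ModuleCat.{max u v} (MvPolynomial σ k))) :=
    preservesFilteredColimitsOfSize_shrink.{0, max u v, 0, max u v} _
  obtain ⟨⟨⟨t'⟩⟩, f, g, hfg⟩ := Concrete.isColimit_exists_of_rep_eq _ hc _ _ hc0
  have h : t ≤ t' := leOfHom f.unop.unop
  refine ⟨t', h, ?_⟩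
  rw [← diagram_map_app I i h]
  exact hfg.trans (map_zero _)

variable {i}

theorem canonicalMap_apply {J : Ideal (MvPolynomial σ k)} {t t' : ℕ} (h : I ^ t ≤ J) (ht : t ≤ t')
    (x : ExtMod i (ModuleCat.of (MvPolynomial σ k) (MvPolynomial σ k ⧸ J)) M) :
    (canonicalMap I J i t h M).hom x = (toLocalCohomology I i t' M).hom
      ((extQuotientMap ((Ideal.pow_le_pow_right ht).trans h) i M).hom x) := by
  have h1 := congr($(extQuotientMap_toLocalCohomology (M := M) I i ht).hom
    ((extQuotientMap h i M).hom x))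
  have h2 := congr($(extQuotientMap_comp (M := M) h (Ideal.pow_le_pow_right ht) i).hom x)
  exact h1.symm.trans (congrArg (toLocalCohomology I i t' M).hom h2)

variable {ℳ : (σ → ℤ) → AddSubgroup M} [Finite σ] {ℓ : ℕ} {α : σ → ℤ}

/-- A class that dies in the limit dies over some $A/\mathfrak m^{t'}$, hence over $A/\mathfrak
m_{\max(\ell,t')}$, and the comparison from $\mathfrak m_\ell$ to that ideal is injective in degree
`α`. -/
theorem eq_zero_of_canonicalMap_eq_zero (hM : IsSquarefree M ℳ) (hα : ∀ s, 1 - (ℓ : ℤ) ≤ α s)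
    {t : ℕ} (h : irrelevantIdeal k σ ^ t ≤ powerIdeal k σ ℓ)
    {x : ExtMod i (ModuleCat.of (MvPolynomial σ k) (MvPolynomial σ k ⧸ powerIdeal k σ ℓ)) M}
    (hx : x ∈ extPiece i _ M (quotientPiece (powerIdeal k σ ℓ)) ℳ α)
    (h0 : (canonicalMap (irrelevantIdeal k σ) (powerIdeal k σ ℓ) i t h M).hom x = 0) : x = 0 := by
  obtain ⟨n, ⟨eq⟩⟩ := Finite.exists_equiv_fin σ
  rw [canonicalMap_apply _ h le_rfl] at h0
  obtain ⟨t', htt', h1⟩ := exists_of_toLocalCohomology_eq_zero _ _ h0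
  have h2 := congr($(extQuotientMap_comp (M := M) h (Ideal.pow_le_pow_right htt') i).hom x)
  have h3 := h2.symm.trans h1
  have hℓ := le_max_left ℓ t'
  have hp : powerIdeal k σ (max ℓ t') ≤ irrelevantIdeal k σ ^ t' :=
    powerIdeal_le_pow (le_max_right ℓ t')
  refine eq_zero_of_ext_map_eq_zero (one_le_of_lcmExp_tsub_ne_zero eq.symm hα) hM
    (powerExp_mono eq.symm hℓ) (monomialIdeal_powerExp eq.symm ℓ)
    (monomialIdeal_powerExp eq.symm (max ℓ t')) (powerIdeal_antitone hℓ) hx ?_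
  have h4 := congr($(extQuotientMap_comp (M := M) ((Ideal.pow_le_pow_right htt').trans h) hp i).hom x)
  exact h4.symm.trans ((congrArg (extQuotientMap hp i M).hom h3).trans (map_zero _))

/-- For surjectivity, a class over $A/\mathfrak m^r$ is pushed to $A/\mathfrak m_{\max(\ell,r)}$ and
from there lifted back to $A/\mathfrak m_\ell$ by the comparison. -/
theorem map_canonicalMap_extPiece (hM : IsSquarefree M ℳ) (hα : ∀ s, 1 - (ℓ : ℤ) ≤ α s)
    {t : ℕ} (h : irrelevantIdeal k σ ^ t ≤ powerIdeal k σ ℓ) :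
    (extPiece i (ModuleCat.of (MvPolynomial σ k) (MvPolynomial σ k ⧸ powerIdeal k σ ℓ)) M
      (quotientPiece (powerIdeal k σ ℓ)) ℳ α).map
      ((canonicalMap (irrelevantIdeal k σ) (powerIdeal k σ ℓ) i t h M).hom.restrictScalars k) =
    localCohomologyPiece (irrelevantIdeal k σ) i M ℳ α := by
  obtain ⟨n, ⟨eq⟩⟩ := Finite.exists_equiv_fin σ
  apply le_antisymm
  · rintro _ ⟨x, hx, rfl⟩
    obtain ⟨n', m', hm'⟩ := exists_monomialIdeal_eq_pow (k := k) (σ := σ) t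
    refine Submodule.mem_iSup_of_mem t ⟨(extQuotientMap h i M).hom x, ?_, rfl⟩
    exact ext_map_mem_extPiece hM.gradedSMul (monomialIdeal_powerExp eq.symm ℓ) hm' h hx
  · refine iSup_le fun r => ?_
    rintro _ ⟨e, he, rfl⟩
    obtain ⟨n', m', hm'⟩ := exists_monomialIdeal_eq_pow (k := k) (σ := σ) r
    have hℓ := le_max_left ℓ r
    have hp : powerIdeal k σ (max ℓ r) ≤ irrelevantIdeal k σ ^ r :=
      powerIdeal_le_pow (le_max_right ℓ r)
    obtain ⟨x, hx, hxe⟩ := exists_ext_map_eq (one_le_of_lcmExp_tsub_ne_zero eq.symm hα) hM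
      (powerExp_mono eq.symm hℓ) (monomialIdeal_powerExp eq.symm ℓ)
      (monomialIdeal_powerExp eq.symm (max ℓ r)) (powerIdeal_antitone hℓ)
      (ext_map_mem_extPiece hM.gradedSMul hm' (monomialIdeal_powerExp eq.symm (max ℓ r)) hp he)
    refine ⟨x, hx, ?_⟩
    -- The exponent `t + r + t'` dominates all three, so that `x` and `e` have the same image over
    -- one common power before the limit is taken.
    obtain ⟨t', ht'⟩ := exists_irrelevantIdeal_pow_le (k := k) (σ := σ) (max ℓ r)
    have hT : irrelevantIdeal k σ ^ (t + r + t') ≤ powerIdeal k σ (max ℓ r) :=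
      (Ideal.pow_le_pow_right (by omega)).trans ht'
    have h1 := canonicalMap_apply (i := i) (M := M) _ h (show t ≤ t + r + t' by omega) x
    have h2 := congr($(extQuotientMap_comp (M := M) (powerIdeal_antitone hℓ) hT i).hom x)
    have h3 := congr($(extQuotientMap_comp (M := M) hp hT i).hom e)
    have h4 := congr($(extQuotientMap_toLocalCohomology (M := M) (irrelevantIdeal k σ) i
      (show r ≤ t + r + t' by omega)).hom e)
    refine h1.trans (Eq.trans (congrArg (toLocalCohomology _ i _ M).hom ?_) h4)
    exact h2.symm.trans ((congrArg (extQuotientMap hT i M).hom hxe).trans h3)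

theorem exists_equiv_localCohomologyPiece (hM : IsSquarefree M ℳ)
    (hα : ∀ s, 1 - (ℓ : ℤ) ≤ α s) {t : ℕ} (h : irrelevantIdeal k σ ^ t ≤ powerIdeal k σ ℓ) :
    ∃ e : extPiece i
          (ModuleCat.of (MvPolynomial σ k) (MvPolynomial σ k ⧸ powerIdeal k σ ℓ)) M
          (quotientPiece (powerIdeal k σ ℓ)) ℳ α ≃ₗ[k]
        localCohomologyPiece (irrelevantIdeal k σ) i M ℳ α,
      ∀ x, (e x).1 =
        (canonicalMap (irrelevantIdeal k σ) (powerIdeal k σ ℓ) i t h M).hom x.1 := by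
  have himg := map_canonicalMap_extPiece (i := i) hM hα h
  have hinj : ∀ x ∈ extPiece i
      (ModuleCat.of (MvPolynomial σ k) (MvPolynomial σ k ⧸ powerIdeal k σ ℓ)) M
      (quotientPiece (powerIdeal k σ ℓ)) ℳ α,
      ((canonicalMap (irrelevantIdeal k σ) (powerIdeal k σ ℓ) i t h M).hom.restrictScalars k) x = 0
        → x = 0 := by
    intro x hx h0
    have h1 : (canonicalMap (irrelevantIdeal k σ) (powerIdeal k σ ℓ) i t h M).hom x = 0 := h0
    exact eq_zero_of_canonicalMap_eq_zero (M := M) (ℳ := ℳ) (α := α) (i := i) (x := x) hM hα h hx h1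
  exact exists_equiv_of_map_eq himg hinj

end LocalCohomology

/-! ### Joins, meets and atoms in simplicial posets -/

section SimplicialPoset

variable {P : Type v} [PartialOrder P] [OrderBot P] [Finite P]

theorem IsAtom.le_or_le_of_le_sup {B : Type*} [BooleanAlgebra B] {x p q : B} (hx : IsAtom x)
    (h : x ≤ p ⊔ q) : x ≤ p ∨ x ≤ q := by
  by_cases hp : x ≤ p
  · exact Or.inl hp
  · have hd : Disjoint x p := hx.not_le_iff_disjoint.1 hp
    exact Or.inr (hd.left_le_of_le_sup_left h)

namespace IsSimplicialPoset

variable (hP : IsSimplicialPoset P)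
include hP

/-- The join exists only inside the interval below `y`. The clause on atoms is distributivity of
that Boolean lattice. -/
theorem exists_sup {w z y : P} (hw : w ≤ y) (hz : z ≤ y) :
    ∃ j ≤ y, w ≤ j ∧ z ≤ j ∧ (∀ b ≤ y, w ≤ b → z ≤ b → j ≤ b) ∧
      ∀ a, IsAtom a → a ≤ j → a ≤ w ∨ a ≤ z := by
  obtain ⟨B, _, ⟨f⟩⟩ := hP.boolean_Iic y
  let w' : Set.Iic y := ⟨w, hw⟩
  let z' : Set.Iic y := ⟨z, hz⟩
  let j : Set.Iic y := f.symm (f w' ⊔ f z')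
  have hwj : w' ≤ j := f.le_symm_apply.2 le_sup_left
  have hzj : z' ≤ j := f.le_symm_apply.2 le_sup_right
  refine ⟨j, j.2, hwj, hzj, fun b hb hwb hzb => ?_, fun a ha haj => ?_⟩
  · have : j ≤ ⟨b, hb⟩ := f.symm_apply_le.2
      (sup_le (f.le_iff_le.2 (show w' ≤ ⟨b, hb⟩ from hwb)) (f.le_iff_le.2 (show z' ≤ ⟨b, hb⟩ from hzb)))
    exact this
  · have hay : a ≤ y := haj.trans j.2
    have hatom : IsAtom (f ⟨a, hay⟩) := (f.isAtom_iff _).2 (ha.Iic hay)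
    have hle : f ⟨a, hay⟩ ≤ f w' ⊔ f z' := f.le_symm_apply.1 (show ⟨a, hay⟩ ≤ j from haj)
    rcases hatom.le_or_le_of_le_sup hle with h | h
    · exact Or.inl (f.le_iff_le.1 h)
    · exact Or.inr (f.le_iff_le.1 h)

theorem exists_isGLB {w z y : P} (hw : w ≤ y) (hz : z ≤ y) : ∃ g, IsGLB {w, z} g := by
  obtain ⟨B, _, ⟨f⟩⟩ := hP.boolean_Iic y
  let w' : Set.Iic y := ⟨w, hw⟩
  let z' : Set.Iic y := ⟨z, hz⟩
  let g : Set.Iic y := f.symm (f w' ⊓ f z')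
  have hgw : g ≤ w' := f.symm_apply_le.2 inf_le_left
  have hgz : g ≤ z' := f.symm_apply_le.2 inf_le_right
  refine ⟨g, ?_, fun b hb => ?_⟩
  · rintro _ (rfl | rfl)
    · exact hgw
    · exact hgz
  · have hbw : b ≤ w := hb (Or.inl rfl)
    have hbz : b ≤ z := hb (Or.inr rfl)
    have : (⟨b, hbw.trans hw⟩ : Set.Iic y) ≤ g := f.le_symm_apply.2
      (le_inf (f.le_iff_le.2 (show _ ≤ w' from hbw)) (f.le_iff_le.2 (show _ ≤ z' from hbz)))
    exact this

/-- Otherwise the Boolean difference of `w` and `z` would be nonzero and contain an atom below `w`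
but not below `z`. -/
theorem le_of_atoms {w z y : P} (hw : w ≤ y) (hz : z ≤ y)
    (h : ∀ a, IsAtom a → a ≤ w → a ≤ z) : w ≤ z := by
  obtain ⟨B, _, ⟨f⟩⟩ := hP.boolean_Iic y
  have : Finite B := Finite.of_equiv _ f.toEquiv
  by_contra hwz
  have hne : f ⟨w, hw⟩ \ f ⟨z, hz⟩ ≠ ⊥ := fun e => hwz (f.le_iff_le.1 (sdiff_eq_bot_iff.1 e))
  obtain ⟨x, hx, hxle⟩ := (IsAtomic.eq_bot_or_exists_atom_le (f ⟨w, hw⟩ \ f ⟨z, hz⟩)).resolve_left hne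
  have hatom : IsAtom (f.symm x) := (f.symm.isAtom_iff _).2 hx
  have hxw : (f.symm x) ≤ ⟨w, hw⟩ := f.symm_apply_le.2 (hxle.trans sdiff_le)
  have hxz : (f.symm x) ≤ ⟨z, hz⟩ := h _ hatom.of_isAtom_coe_Iic hxw
  have h1 : x ≤ f ⟨z, hz⟩ := f.symm_apply_le.1 hxz
  exact hx.1 (disjoint_self.1 (disjoint_sdiff_self_left.mono hxle h1))

/-- The Boolean complement of `a` below `v`. For such a pair the meet in the face relation is `⊥`,
that is, the unit of the ring. -/
theorem exists_complement {a v : P} (hav : a ≤ v) :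
    ∃ v' ≤ v, IsGLB {a, v'} ⊥ ∧ v ∈ minUpperBounds a v' := by
  obtain ⟨B, _, ⟨f⟩⟩ := hP.boolean_Iic v
  let a' : Set.Iic v := ⟨a, hav⟩
  let v' : Set.Iic v := f.symm (f a')ᶜ
  refine ⟨v', v'.2, ⟨fun _ _ => bot_le, fun b hb => ?_⟩, ⟨hav, v'.2⟩, fun b hb hbv => ?_⟩
  · have hba : b ≤ a := hb (Or.inl rfl)
    have hbv' : b ≤ v' := hb (Or.inr rfl)
    have h1 : f ⟨b, hba.trans hav⟩ ≤ f a' := f.le_iff_le.2 hba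
    have h2 : f ⟨b, hba.trans hav⟩ ≤ (f a')ᶜ := f.le_symm_apply.1 (show _ ≤ v' from hbv')
    have h3 : f ⟨b, hba.trans hav⟩ ≤ f ⟨⊥, bot_le⟩ :=
      (le_inf h1 h2).trans (by rw [inf_compl_eq_bot]; exact bot_le)
    exact f.le_iff_le.1 h3
  · have h1 : f a' ≤ f ⟨b, hbv⟩ := f.le_iff_le.2 hb.1
    have h2 : (f a')ᶜ ≤ f ⟨b, hbv⟩ := f.symm_apply_le.1 (show v' ≤ ⟨b, hbv⟩ from hb.2)
    have h3 : f ⟨v, le_rfl⟩ ≤ f ⟨b, hbv⟩ :=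
      le_top.trans ((sup_compl_eq_top (x := f a')).ge.trans (sup_le h1 h2))
    exact f.le_iff_le.1 h3

theorem minUpperBounds_nonempty {w z y : P} (hw : w ≤ y) (hz : z ≤ y) :
    ∃ j ∈ minUpperBounds w z, j ≤ y := by
  obtain ⟨j, hjy, hwj, hzj, hmin, -⟩ := hP.exists_sup hw hz
  exact ⟨j, ⟨⟨hwj, hzj⟩, fun b hb hbj => hmin b (hbj.trans hjy) hb.1 hb.2⟩, hjy⟩

/-- Both coincide with a join below `j`. Hence distinct minimal upper bounds of a pair have no
common upper bound, and their product in the face ring is zero. -/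
theorem minUpperBounds_unique {w z y j j' : P} (hj : j ∈ minUpperBounds w z)
    (hj' : j' ∈ minUpperBounds w z) (hjy : j ≤ y) (hjy' : j' ≤ y) : j = j' := by
  obtain ⟨i, -, hwi, hzi, hmin, -⟩ := hP.exists_sup (hj.1.1.trans hjy) (hj.1.2.trans hjy)
  have h1 : i ≤ j := hmin j hjy hj.1.1 hj.1.2
  have h2 : i ≤ j' := hmin j' hjy' hj'.1.1 hj'.1.2
  exact (le_antisymm (hj.2 ⟨hwi, hzi⟩ h1) h1).trans (le_antisymm h2 (hj'.2 ⟨hwi, hzi⟩ h2))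

theorem atom_le_minUpperBound_iff {w z j a : P} (hj : j ∈ minUpperBounds w z) (ha : IsAtom a) :
    a ≤ j ↔ a ≤ w ∨ a ≤ z := by
  constructor
  · obtain ⟨i, hij, hwi, hzi, -, hi⟩ := hP.exists_sup hj.1.1 hj.1.2
    obtain rfl := le_antisymm hij (hj.2 ⟨hwi, hzi⟩ hij)
    exact hi a ha
  · rintro (h | h)
    · exact h.trans hj.1.1
    · exact h.trans hj.1.2

end IsSimplicialPoset

open Classical in
/-- The exponent of the squarefree monomial of the vertices below `y`. -/
def suppExp (y : P) : PosetVertex P →₀ ℕ :=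
  Finsupp.equivFunOnFinite.symm fun a => if a.1 ≤ y then 1 else 0

open Classical in
theorem suppExp_apply (y : P) (a : PosetVertex P) : suppExp y a = if a.1 ≤ y then 1 else 0 := rfl

theorem suppExp_ne_zero_iff {y : P} {a : PosetVertex P} : suppExp y a ≠ 0 ↔ a.1 ≤ y := by
  rw [suppExp_apply]
  split_ifs with h <;> simp [h]

theorem expDegree_suppExp (y : P) : expDegree (suppExp y) = supportDegree y := by
  funext a
  rw [expDegree, suppExp_apply, supportDegree]
  split_ifs <;> rfl

theorem suppExp_bot : suppExp (⊥ : P) = 0 := by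
  ext a
  rw [suppExp_apply, if_neg fun h => a.2.1 (le_bot_iff.1 h)]
  rfl

theorem suppExp_atom (a : PosetVertex P) : suppExp a.1 = Finsupp.single a 1 := by
  classical
  ext b
  rw [suppExp_apply, Finsupp.single_apply]
  have : b.1 ≤ a.1 ↔ a = b :=
    ⟨fun h => Subtype.ext ((a.2.le_iff.1 h).resolve_left b.2.1).symm, fun h => h ▸ le_rfl⟩
  simp only [this]

/-- The vertices of `g` and `j` are the intersection and the union of those of `w` and `z`. This
makes the face relations homogeneous. -/
theorem suppExp_add (hP : IsSimplicialPoset P) {w z g j : P} (hg : IsGLB {w, z} g)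
    (hj : j ∈ minUpperBounds w z) : suppExp g + suppExp j = suppExp w + suppExp z := by
  ext a
  have h1 : a.1 ≤ g ↔ a.1 ≤ w ∧ a.1 ≤ z := by
    rw [le_isGLB_iff hg]; simp [lowerBounds]
  have h2 := hP.atom_le_minUpperBound_iff hj a.2
  simp only [Finsupp.add_apply, suppExp_apply]
  by_cases h3 : a.1 ≤ w <;> by_cases h4 : a.1 ≤ z <;> simp [h1, h2, h3, h4]

end SimplicialPoset

/-! ### Relations in the face ring -/

section FaceRingStructure

variable {k : Type u} [Field k] {P : Type v} [PartialOrder P] [OrderBot P]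

/-- The element of the face ring given by an element of the poset. -/
def faceVar (k : Type u) [Field k] {P : Type v} [PartialOrder P] [OrderBot P] (y : P) :
    FaceRing k P := faceRingMk k P (X y)

theorem faceRingMk_eq_zero {f : MvPolynomial P k} (hf : f ∈ faceIdeal k P) :
    faceRingMk k P f = 0 := Ideal.Quotient.eq_zero_iff_mem.2 hf

theorem faceRingMk_surjective : Function.Surjective (faceRingMk k P) :=
  Ideal.Quotient.mk_surjective

theorem faceVar_bot : faceVar k (⊥ : P) = 1 := by
  have : faceRingMk k P (X ⊥ - 1) = 0 := faceRingMk_eq_zero (Ideal.subset_span (Or.inr rfl))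
  rwa [map_sub, map_one, sub_eq_zero] at this

theorem faceVar_mul_eq_zero {w y : P} (h : minUpperBounds w y = ∅) :
    faceVar k w * faceVar k y = 0 := by
  rw [faceVar, faceVar, ← map_mul]
  exact faceRingMk_eq_zero (Ideal.subset_span (Or.inl (Or.inl ⟨w, y, h, rfl⟩)))

theorem algebraMap_X (a : PosetVertex P) :
    algebraMap (VertexRing k P) (FaceRing k P) (X a) = faceVar k a.1 := by
  change faceRingMk k P (rename Subtype.val (X a)) = _
  rw [rename_X]
  rfl

variable [Finite P]

theorem faceVar_mul {w y g : P} (h : (minUpperBounds w y).Nonempty) (hg : IsGLB {w, y} g) :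
    faceVar k w * faceVar k y =
      faceVar k g * ∑ z ∈ (Set.toFinite (minUpperBounds w y)).toFinset, faceVar k z := by
  have := faceRingMk_eq_zero (k := k)
    (Ideal.subset_span (Or.inl (Or.inr ⟨w, y, g, h, hg, rfl⟩)))
  rw [finsum_mem_eq_finite_toFinset_sum _ (Set.toFinite _), map_sub, map_mul, map_mul, map_sum,
    sub_eq_zero] at this
  exact this

variable (hP : IsSimplicialPoset P)
include hP

/-- Induction on `v`, splitting off an atom `a` with complement `v'`. The product of `a` and `v'` is
the sum of their minimal upper bounds, and multiplication by `z` kills all of these except `v`,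
because they share no upper bound with `z`. -/
theorem algebraMap_suppExp_mul {v z : P} (hvz : v ≤ z) :
    algebraMap (VertexRing k P) (FaceRing k P) (monomial (suppExp v) 1) * faceVar k z =
      faceVar k v * faceVar k z := by
  induction v using WellFoundedLT.induction with
  | ind v ih =>
    by_cases hv : v = ⊥
    · subst hv
      rw [suppExp_bot, faceVar_bot]
      exact congrArg (· * _) (map_one _)
    · obtain ⟨a, ha, hav⟩ := (IsAtomic.eq_bot_or_exists_atom_le v).resolve_left hv
      obtain ⟨v', hv', hglb, hmin⟩ := hP.exists_complement hav
      have hlt : v' < v := lt_of_le_of_ne hv' fun e =>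
        ha.1 (le_bot_iff.1 (hglb.2 (by rintro _ (rfl | rfl); exacts [le_rfl, e ▸ hav])))
      have hexp := suppExp_add hP hglb hmin
      rw [suppExp_bot, zero_add, suppExp_atom ⟨a, ha⟩] at hexp
      have hX : (monomial (suppExp v) 1 : VertexRing k P) =
          X ⟨a, ha⟩ * monomial (suppExp v') 1 := by
        rw [hexp, X, monomial_mul, one_mul]
      rw [hX, map_mul, mul_assoc, ih v' hlt (hv'.trans hvz), algebraMap_X, ← mul_assoc,
        faceVar_mul ⟨v, hmin⟩ hglb, faceVar_bot, one_mul, Finset.sum_mul,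
        Finset.sum_eq_single v]
      · intro z' hz' hne
        refine faceVar_mul_eq_zero (Set.eq_empty_iff_forall_notMem.2 fun y hy => hne ?_)
        exact hP.minUpperBounds_unique ((Set.Finite.mem_toFinset _).1 hz') hmin hy.1.1
          (hvz.trans hy.1.2)
      · intro h
        exact absurd ((Set.Finite.mem_toFinset _).2 hmin) h

end FaceRingStructure

/-! ### Restriction of the face ring to a face -/

section FaceEval

variable {k : Type u} [Field k] {P : Type v} [PartialOrder P] [OrderBot P] [Finite P]

open Classical in
/-- Restriction to the face `w`, on the polynomial ring on all elements of `P`. -/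
def faceEvalAux (k : Type u) [Field k] (w : P) : MvPolynomial P k →ₐ[k] VertexRing k P :=
  aeval fun z => if z ≤ w then monomial (suppExp z) 1 else 0

theorem faceEvalAux_X_of_le {w z : P} (h : z ≤ w) :
    faceEvalAux k w (X z) = monomial (suppExp z) 1 := by
  rw [faceEvalAux, aeval_X, if_pos h]

theorem faceEvalAux_X_of_not_le {w z : P} (h : ¬ z ≤ w) : faceEvalAux k w (X z) = 0 := by
  rw [faceEvalAux, aeval_X, if_neg h]

variable (hP : IsSimplicialPoset P)
include hP

/-- Two elements below `w` have exactly one minimal upper bound below `w`, so the relation restricts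
to an identity of monomials. If one of them is not below `w`, no upper bound is, and both sides
restrict to zero. -/
theorem faceEvalAux_faceIdeal (w : P) (f : MvPolynomial P k) (hf : f ∈ faceIdeal k P) :
    faceEvalAux k w f = 0 := by
  have : faceIdeal k P ≤ RingHom.ker (faceEvalAux k w).toRingHom := by
    rw [faceIdeal, Ideal.span_le]
    rintro _ ((⟨x, y, h, rfl⟩ | ⟨x, y, g, h, hg, rfl⟩) | rfl)
    · change faceEvalAux k w (X x * X y) = 0
      rw [map_mul]
      by_cases hx : x ≤ w
      · by_cases hy : y ≤ w
        · obtain ⟨j, hj, -⟩ := hP.minUpperBounds_nonempty hx hy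
          exact absurd hj (h ▸ Set.notMem_empty j)
        · rw [faceEvalAux_X_of_not_le hy, mul_zero]
      · rw [faceEvalAux_X_of_not_le hx, zero_mul]
    · change faceEvalAux k w (X x * X y - X g * ∑ᶠ z ∈ minUpperBounds x y, X z) = 0
      rw [finsum_mem_eq_finite_toFinset_sum _ (Set.toFinite _), map_sub, map_mul, map_mul, map_sum,
        sub_eq_zero]
      by_cases hxy : x ≤ w ∧ y ≤ w
      · obtain ⟨j, hj, hjw⟩ := hP.minUpperBounds_nonempty hxy.1 hxy.2
        have hgx : g ≤ x := hg.1 (Or.inl rfl)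
        rw [Finset.sum_eq_single j, faceEvalAux_X_of_le hxy.1, faceEvalAux_X_of_le hxy.2,
          faceEvalAux_X_of_le hjw, faceEvalAux_X_of_le (hgx.trans hxy.1), monomial_mul,
          monomial_mul, suppExp_add hP hg hj]
        · intro z hz hzj
          refine faceEvalAux_X_of_not_le fun hzw => hzj ?_
          exact hP.minUpperBounds_unique ((Set.Finite.mem_toFinset _).1 hz) hj hzw hjw
        · intro h'
          exact absurd ((Set.Finite.mem_toFinset _).2 hj) h'
      · rw [Finset.sum_eq_zero, mul_zero]
        · by_cases hx : x ≤ w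
          · rw [faceEvalAux_X_of_not_le fun hy => hxy ⟨hx, hy⟩, mul_zero]
          · rw [faceEvalAux_X_of_not_le hx, zero_mul]
        · intro z hz
          have hz := (Set.Finite.mem_toFinset _).1 hz
          exact faceEvalAux_X_of_not_le fun hzw => hxy ⟨hz.1.1.trans hzw, hz.1.2.trans hzw⟩
    · change faceEvalAux k w (X ⊥ - 1) = 0
      rw [map_sub, map_one, faceEvalAux_X_of_le bot_le, suppExp_bot]
      exact sub_self _
  exact this hf

/-- Restriction of the face ring to the face `w`. -/
def faceEval (k : Type u) [Field k] (w : P) : FaceRing k P →+* VertexRing k P :=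
  Ideal.Quotient.lift (faceIdeal k P) (faceEvalAux k w).toRingHom (faceEvalAux_faceIdeal hP w)

theorem faceEval_mk (w : P) (f : MvPolynomial P k) :
    faceEval hP k w (faceRingMk k P f) = faceEvalAux k w f :=
  Ideal.Quotient.lift_mk _ _ _

theorem faceEval_algebraMap_monomial {w : P} {d : PosetVertex P →₀ ℕ}
    (hd : ∀ a, d a ≠ 0 → a.1 ≤ w) (c : k) :
    faceEval hP k w (algebraMap (VertexRing k P) (FaceRing k P) (monomial d c)) =
      monomial d c := by
  have : ∀ f : VertexRing k P, algebraMap (VertexRing k P) (FaceRing k P) f =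
    faceRingMk k P (rename Subtype.val f) := fun f => rfl
  rw [this, faceEval_mk, faceEvalAux, aeval_rename, aeval_monomial, monomial_eq]
  refine congrArg _ (Finsupp.prod_congr fun a ha => ?_)
  rw [Function.comp_apply, if_pos (hd a (Finsupp.mem_support_iff.1 ha)), suppExp_atom]
  rfl

end FaceEval

/-! ### Straightening into standard monomials -/

section StandardMonomials

variable {k : Type u} [Field k] {P : Type v} [PartialOrder P] [OrderBot P]

theorem faceRing_algebraMap_eq (f : VertexRing k P) : algebraMap (VertexRing k P) (FaceRing k P) f =
    faceRingMk k P (rename Subtype.val f) := rfl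

variable [Finite P]

/-- The standard monomial of exponent `e` with top element `y`. -/
def standardMonomial (e : PosetVertex P →₀ ℕ) (y : P) (c : k) : FaceRing k P :=
  algebraMap (VertexRing k P) (FaceRing k P) (monomial (e - suppExp y) c) * faceVar k y

/-- The support of the exponent `e` is the set of vertices of `y`. -/
def HasSupport (e : PosetVertex P →₀ ℕ) (y : P) : Prop := ∀ a, e a ≠ 0 ↔ a.1 ≤ y

theorem HasSupport.suppExp_le {e : PosetVertex P →₀ ℕ} {y : P} (h : HasSupport e y) :
    suppExp y ≤ e := by
  intro a
  rw [suppExp_apply]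
  split_ifs with h'
  · exact Nat.one_le_iff_ne_zero.2 ((h a).2 h')
  · exact Nat.zero_le _

/-- The element `x` is a combination of standard monomials of exponent `e`. -/
def IsStandardSum (e : PosetVertex P →₀ ℕ) (x : FaceRing k P) : Prop :=
  ∃ c : P → k, (∀ y, c y ≠ 0 → HasSupport e y) ∧ x = ∑ᶠ y, standardMonomial e y (c y)

theorem standardMonomial_add (e : PosetVertex P →₀ ℕ) (y : P) (c c' : k) :
    standardMonomial e y (c + c') = standardMonomial e y c + standardMonomial e y c' := by
  rw [standardMonomial, standardMonomial, standardMonomial, map_add, map_add, add_mul]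

theorem standardMonomial_zero (e : PosetVertex P →₀ ℕ) (y : P) :
    standardMonomial e y (0 : k) = 0 := by
  rw [standardMonomial, map_zero, map_zero, zero_mul]

namespace IsStandardSum

variable {e : PosetVertex P →₀ ℕ} {x x' : FaceRing k P}

theorem zero : IsStandardSum e (0 : FaceRing k P) :=
  ⟨0, fun _ h => absurd rfl h, by
    simp only [Pi.zero_apply, standardMonomial_zero, finsum_zero]⟩

theorem add (h : IsStandardSum e x) (h' : IsStandardSum e x') : IsStandardSum e (x + x') := by
  obtain ⟨c, hc, rfl⟩ := h
  obtain ⟨c', hc', rfl⟩ := h'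
  refine ⟨c + c', fun y hy => ?_, ?_⟩
  · by_cases h : c y = 0
    · exact hc' y fun h' => hy (by rw [Pi.add_apply, h, h', add_zero])
    · exact hc y h
  · rw [← finsum_add_distrib (Set.toFinite _) (Set.toFinite _)]
    simp only [Pi.add_apply, standardMonomial_add]

theorem sum {ι : Type*} {s : Finset ι} {f : ι → FaceRing k P}
    (h : ∀ i ∈ s, IsStandardSum e (f i)) : IsStandardSum e (∑ i ∈ s, f i) :=
  Finset.sum_induction _ _ (fun _ _ => add) zero h

theorem single {y : P} (hy : HasSupport e y) (c : k) :
    IsStandardSum e (standardMonomial e y c) := by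
  classical
  refine ⟨Pi.single y c, fun z hz => ?_, ?_⟩
  · rw [Pi.single_apply] at hz
    split_ifs at hz with h
    · exact h ▸ hy
    · exact absurd rfl hz
  · rw [finsum_eq_single _ y, Pi.single_eq_same]
    intro z hz
    rw [Pi.single_eq_of_ne hz, standardMonomial_zero]

/-- The relation replaces $wy$ by the meet `g` times the sum of the minimal upper bounds `z`. As `g
≤ z`, the factor `g` can be traded for its monomial in the vertices, leaving standard monomials with
top `z`. -/
theorem faceVar_mul (hP : IsSimplicialPoset P) (h : IsStandardSum e x) (w : P) :
    IsStandardSum (e + suppExp w) (faceVar k w * x) := by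
  classical
  have := Fintype.ofFinite P
  obtain ⟨c, hc, rfl⟩ := h
  rw [finsum_eq_sum_of_fintype, Finset.mul_sum]
  refine sum fun y _ => ?_
  by_cases hcy : c y = 0
  · rw [hcy, standardMonomial_zero, mul_zero]; exact zero
  have hy := hc y hcy
  rw [standardMonomial, mul_left_comm]
  obtain h | ⟨j, hj⟩ := (minUpperBounds w y).eq_empty_or_nonempty
  · rw [faceVar_mul_eq_zero h, mul_zero]; exact zero
  obtain ⟨g, hg⟩ := hP.exists_isGLB hj.1.1 hj.1.2
  rw [_root_.faceVar_mul ⟨j, hj⟩ hg, Finset.mul_sum, Finset.mul_sum]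
  refine sum fun z hz => ?_
  have hz := (Set.Finite.mem_toFinset _).1 hz
  have hgz : g ≤ z := (hg.1 (Or.inl rfl)).trans hz.1.1
  have hexp := suppExp_add hP hg hz
  have hsupp : HasSupport (e + suppExp w) z := by
    intro a
    rw [hP.atom_le_minUpperBound_iff hz a.2, ← hy a, ← suppExp_ne_zero_iff, Finsupp.add_apply]
    omega
  have hle := hy.suppExp_le
  have heq : e - suppExp y + suppExp g = e + suppExp w - suppExp z := by
    ext a
    have h1 := hle a
    have h2 := DFunLike.congr_fun hexp a
    simp only [Finsupp.add_apply, Finsupp.tsub_apply] at h1 h2 ⊢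
    omega
  rw [← algebraMap_suppExp_mul hP hgz, ← mul_assoc, ← map_mul, monomial_mul, mul_one, heq]
  exact single hsupp (c y)

end IsStandardSum

/-- The exponent in the vertices of a monomial in the elements of `P`. -/
def vertexExp (D : P →₀ ℕ) : PosetVertex P →₀ ℕ := D.sum fun z n => n • suppExp z

theorem vertexExp_add (D D' : P →₀ ℕ) : vertexExp (D + D') = vertexExp D + vertexExp D' :=
  Finsupp.sum_add_index' (fun _ => zero_smul _ _) fun _ _ _ => add_smul _ _ _

theorem vertexExp_single (z : P) : vertexExp (Finsupp.single z 1) = suppExp z := by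
  rw [vertexExp, Finsupp.sum_single_index (h := fun z n => n • suppExp z) (zero_smul ℕ _), one_smul]

theorem weight_supportDegree (D : P →₀ ℕ) :
    Finsupp.weight supportDegree D = expDegree (vertexExp D) := by
  induction D using Finsupp.induction_linear with
  | zero => rw [map_zero, vertexExp, Finsupp.sum_zero_index, expDegree_zero]
  | add D D' h h' => rw [map_add, vertexExp_add, expDegree_add, h, h']
  | single z n =>
    rw [Finsupp.weight_single, vertexExp, Finsupp.sum_single_index (h := fun z n => n • suppExp z) (zero_smul ℕ _),
      ← expDegree_suppExp]
    funext a
    simp [expDegree]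

theorem vertexExp_zero : vertexExp (0 : P →₀ ℕ) = 0 := Finsupp.sum_zero_index

theorem vertexExp_mapDomain (d : PosetVertex P →₀ ℕ) :
    vertexExp (d.mapDomain Subtype.val) = d := by
  induction d using Finsupp.induction_linear with
  | zero => rw [Finsupp.mapDomain_zero, vertexExp_zero]
  | add d d' h h' => rw [Finsupp.mapDomain_add, vertexExp_add, h, h']
  | single a n =>
    rw [Finsupp.mapDomain_single, vertexExp,
      Finsupp.sum_single_index (h := fun z n => n • suppExp z) (zero_smul ℕ _), suppExp_atom,
      Finsupp.smul_single, smul_eq_mul, mul_one]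

theorem IsStandardSum.monomial_mul (hP : IsSimplicialPoset P) (D : P →₀ ℕ)
    {e : PosetVertex P →₀ ℕ} {x : FaceRing k P} (h : IsStandardSum e x) :
    IsStandardSum (e + vertexExp D) (faceRingMk k P (monomial D 1) * x) := by
  have hadd : ∀ D D' : P →₀ ℕ,
      (∀ e (x : FaceRing k P), IsStandardSum e x →
        IsStandardSum (e + vertexExp D) (faceRingMk k P (monomial D 1) * x)) →
      (∀ e (x : FaceRing k P), IsStandardSum e x →
        IsStandardSum (e + vertexExp D') (faceRingMk k P (monomial D' 1) * x)) →
      ∀ e (x : FaceRing k P), IsStandardSum e x →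
        IsStandardSum (e + vertexExp (D + D')) (faceRingMk k P (monomial (D + D') 1) * x) := by
    intro D D' hD hD' e x hx
    have : (monomial (D + D') 1 : MvPolynomial P k) = monomial D' 1 * monomial D 1 := by
      rw [MvPolynomial.monomial_mul, one_mul, add_comm]
    rw [vertexExp_add, ← add_assoc, this, map_mul, mul_assoc]
    exact hD' _ _ (hD _ _ hx)
  have hzero : ∀ e (x : FaceRing k P), IsStandardSum e x →
      IsStandardSum (e + vertexExp 0) (faceRingMk k P (monomial 0 1) * x) := by
    intro e x hx
    have : faceRingMk k P (monomial 0 1) = 1 := map_one _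
    rwa [vertexExp_zero, add_zero, this, one_mul]
  induction D using Finsupp.induction_linear generalizing e x with
  | zero => exact hzero e x h
  | add D D' hD hD' => exact hadd D D' (fun _ _ => hD) (fun _ _ => hD') e x h
  | single z n =>
    induction n generalizing e x with
    | zero => rw [Finsupp.single_zero]; exact hzero e x h
    | succ n ih =>
      rw [Finsupp.single_add]
      refine hadd _ _ (fun _ _ => ih) (fun e x hx => ?_) e x h
      rw [vertexExp_single]
      exact hx.faceVar_mul hP z

omit [Finite P] in
theorem hasSupport_zero_bot : HasSupport (0 : PosetVertex P →₀ ℕ) (⊥ : P) :=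
  fun a => ⟨fun h => absurd rfl h, fun h => absurd (le_bot_iff.1 h) a.2.1⟩

theorem isStandardSum_monomial (hP : IsSimplicialPoset P) (D : P →₀ ℕ) (c : k) :
    IsStandardSum (vertexExp D) (faceRingMk k P (monomial D c)) := by
  have h1 : standardMonomial 0 (⊥ : P) c = faceRingMk k P (C c) := by
    rw [standardMonomial, faceVar_bot, mul_one, zero_tsub, faceRing_algebraMap_eq]
    exact congrArg _ (rename_C _ _)
  have h2 : (monomial D c : MvPolynomial P k) = monomial D 1 * C c := by
    rw [mul_comm, C_mul_monomial, mul_one]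
  rw [h2, map_mul, ← h1, ← zero_add (vertexExp D)]
  exact (IsStandardSum.single hasSupport_zero_bot c).monomial_mul hP D

end StandardMonomials

/-! ### The grading of the face ring and its squarefreeness -/

section FaceRingGrading

variable {k : Type u} [Field k] {P : Type v} [PartialOrder P] [OrderBot P] [Finite P]
  {β γ : PosetVertex P → ℤ} {e : PosetVertex P →₀ ℕ}

theorem monomial_mem_faceRingPiece (D : P →₀ ℕ) (c : k) :
    faceRingMk k P (monomial D c) ∈ faceRingPiece k P (expDegree (vertexExp D)) :=
  ⟨_, isWeightedHomogeneous_monomial _ _ _ (weight_supportDegree D), rfl⟩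

omit [Finite P] in
theorem faceVar_mem_faceRingPiece (y : P) : faceVar k y ∈ faceRingPiece k P (supportDegree y) :=
  ⟨_, isWeightedHomogeneous_X k _ y, rfl⟩

omit [Finite P] in
theorem mul_mem_faceRingPiece {u u' : FaceRing k P} (h : u ∈ faceRingPiece k P β)
    (h' : u' ∈ faceRingPiece k P γ) : u * u' ∈ faceRingPiece k P (β + γ) := by
  obtain ⟨f, hf, rfl⟩ := h
  obtain ⟨f', hf', rfl⟩ := h'
  exact ⟨f * f', IsWeightedHomogeneous.mul hf hf', map_mul (faceRingMk k P) f f'⟩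

theorem algebraMap_mem_faceRingPiece {f : VertexRing k P} (hf : f ∈ polyPiece k β) :
    algebraMap (VertexRing k P) (FaceRing k P) f ∈ faceRingPiece k P β := by
  obtain rfl | ⟨d, c, rfl, rfl⟩ := polyPiece_zero_or_monomial hf
  · rw [map_zero]; exact zero_mem _
  · have := monomial_mem_faceRingPiece (k := k) (d.mapDomain Subtype.val) c
    rwa [vertexExp_mapDomain, ← rename_monomial] at this

theorem standardMonomial_mem_faceRingPiece {y : P} (hy : HasSupport e y) (c : k) :
    standardMonomial e y c ∈ faceRingPiece k P (expDegree e) := by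
  have := mul_mem_faceRingPiece
    (algebraMap_mem_faceRingPiece (monomial_mem_polyPiece (e - suppExp y) c))
    (faceVar_mem_faceRingPiece y)
  rwa [← expDegree_suppExp, ← expDegree_add, tsub_add_cancel_of_le hy.suppExp_le] at this

theorem IsStandardSum.mem_faceRingPiece {x : FaceRing k P} (h : IsStandardSum e x) :
    x ∈ faceRingPiece k P (expDegree e) := by
  obtain ⟨c, hc, rfl⟩ := h
  refine finsum_induction (· ∈ faceRingPiece k P (expDegree e)) (zero_mem _)
    (fun _ _ => add_mem) fun y => ?_
  by_cases h : c y = 0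
  · rw [h, standardMonomial_zero]; exact zero_mem _
  · exact standardMonomial_mem_faceRingPiece (hc y h) _

variable (hP : IsSimplicialPoset P)
include hP

/-- All monomials of a nonzero homogeneous polynomial have the same exponent in the vertices. The
zero alternative covers degrees with a negative entry. -/
theorem zero_or_isStandardSum {u : FaceRing k P} (hu : u ∈ faceRingPiece k P γ) :
    u = 0 ∨ ∃ e, expDegree e = γ ∧ IsStandardSum e u := by
  obtain ⟨f, hf, rfl⟩ := hu
  have hf : IsWeightedHomogeneous supportDegree f γ := hf
  by_cases h : f = 0
  · exact Or.inl (by rw [h]; exact map_zero (faceRingMk k P))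
  · obtain ⟨d, hd⟩ := MvPolynomial.ne_zero_iff.1 h
    refine Or.inr ⟨vertexExp d, (weight_supportDegree d).symm.trans (hf hd), ?_⟩
    change IsStandardSum _ (faceRingMk k P f)
    rw [f.as_sum, map_sum]
    refine IsStandardSum.sum fun D hD => ?_
    have : vertexExp D = vertexExp d := expDegree_injective <| by
      rw [← weight_supportDegree, ← weight_supportDegree, hf hd, hf (mem_support_iff.1 hD)]
    rw [← this]
    exact isStandardSum_monomial hP D _

open Classical in
theorem faceEval_standardMonomial (w : P) {y : P} (hy : HasSupport e y) (c : k) :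
    faceEval hP k w (standardMonomial e y c) = if y ≤ w then monomial e c else 0 := by
  rw [standardMonomial, map_mul]
  split_ifs with h
  · rw [faceEval_algebraMap_monomial hP, faceVar, faceEval_mk, faceEvalAux_X_of_le h,
      MvPolynomial.monomial_mul, mul_one, tsub_add_cancel_of_le hy.suppExp_le]
    intro a ha
    refine ((hy a).1 fun h0 => ha ?_).trans h
    rw [Finsupp.tsub_apply, h0, zero_tsub]
  · rw [faceVar, faceEval_mk, faceEvalAux_X_of_not_le h, mul_zero]

theorem faceEval_mem_polyPiece (w : P) {u : FaceRing k P} (hu : u ∈ faceRingPiece k P γ) :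
    faceEval hP k w u ∈ polyPiece k γ := by
  obtain rfl | ⟨e, rfl, c, hc, rfl⟩ := zero_or_isStandardSum hP hu
  · rw [map_zero]; exact zero_mem _
  · refine finsum_induction (fun x => faceEval hP k w x ∈ polyPiece k (expDegree e))
      (by rw [map_zero]; exact zero_mem _) (fun x y hx hy => by rw [map_add]; exact add_mem hx hy)
      fun y => ?_
    by_cases h : c y = 0
    · rw [h, standardMonomial_zero, map_zero]; exact zero_mem _
    · rw [faceEval_standardMonomial hP w (hc y h)]
      split_ifs
      · exact monomial_mem_polyPiece _ _
      · exact zero_mem _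

/-- Restriction to `w` isolates the coefficient of the standard monomial with top `w`: another top
with the same vertices cannot lie below `w`, since elements of an interval are determined by their
atoms. -/
theorem IsStandardSum.eq_zero_of_faceEval {x : FaceRing k P} (h : IsStandardSum e x)
    (h0 : ∀ w, HasSupport e w → faceEval hP k w x = 0) : x = 0 := by
  classical
  have := Fintype.ofFinite P
  obtain ⟨c, hc, rfl⟩ := h
  have hc0 : ∀ w, c w = 0 := by
    intro w
    by_contra hw
    have hsw := hc w hw
    have := h0 w hsw
    rw [finsum_eq_sum_of_fintype, map_sum, Finset.sum_eq_single w,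
      faceEval_standardMonomial hP w hsw, if_pos le_rfl, monomial_eq_zero] at this
    · exact hw this
    · intro y _ hyw
      by_cases hy : c y = 0
      · rw [hy, standardMonomial_zero, map_zero]
      · rw [faceEval_standardMonomial hP w (hc y hy), if_neg]
        intro hle
        exact hyw (le_antisymm hle (hP.le_of_atoms le_rfl hle fun a ha haw =>
          (hc y hy ⟨a, ha⟩).1 ((hsw ⟨a, ha⟩).2 haw)))
    · exact fun h => absurd (Finset.mem_univ w) h
  simp only [hc0, standardMonomial_zero, finsum_zero]

omit hP in
theorem iSup_faceRingPiece : ⨆ γ, faceRingPiece k P γ = ⊤ := by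
  rw [eq_top_iff]
  intro u _
  obtain ⟨f, rfl⟩ := faceRingMk_surjective u
  induction f using MvPolynomial.induction_on' with
  | monomial d c => exact AddSubgroup.mem_iSup_of_mem _ (monomial_mem_faceRingPiece d c)
  | add p q hp hq => rw [map_add]; exact add_mem (hp trivial) (hq trivial)

open Classical in
theorem isInternal_faceRingPiece : DirectSum.IsInternal (faceRingPiece k P) := by
  refine isInternal_of_separating (fun w => (faceEval hP k w).toAddMonoidHom) (polyProj k)
    (fun w γ x hx => polyProj_of_mem (faceEval_mem_polyPiece hP w hx))
    (fun w γ γ' h x hx => polyProj_of_mem_ne h (faceEval_mem_polyPiece hP w hx))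
    (fun γ x hx h => ?_) iSup_faceRingPiece
  obtain rfl | ⟨e, -, he⟩ := zero_or_isStandardSum hP hx
  · rfl
  · exact he.eq_zero_of_faceEval hP fun w _ => h w

/-- When `γ` is positive on the support of `d`, adding `d` does not enlarge the support of an
exponent. Multiplication then matches the standard monomials of the two degrees, top by top. -/
theorem isSquarefree_faceRing :
    IsSquarefree (ModuleCat.of (VertexRing k P) (FaceRing k P)) (faceRingPiece k P) where
  isInternal := isInternal_faceRingPiece hP
  gradedSMul := by
    intro β γ a x ha hx
    exact mul_mem_faceRingPiece (algebraMap_mem_faceRingPiece ha) hx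
  eq_zero := by
    intro d γ hγ x hx h
    obtain h' | ⟨e, rfl, he⟩ := zero_or_isStandardSum hP hx
    · exact h'
    · refine he.eq_zero_of_faceEval hP fun w hw => ?_
      have h1 : algebraMap (VertexRing k P) (FaceRing k P) (monomial d 1) * x = 0 := h
      have h2 := congrArg (faceEval hP k w) h1
      rw [map_mul, map_zero, faceEval_algebraMap_monomial hP] at h2
      · refine (mul_eq_zero.1 h2).resolve_left fun h3 => ?_
        exact one_ne_zero (monomial_eq_zero.1 h3)
      · intro a ha
        refine (hw a).1 fun h0 => ?_
        have := hγ a ha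
        rw [expDegree, h0] at this
        exact absurd this (by norm_num)
  exists_smul := by
    intro d γ hγ y hy
    obtain h' | ⟨e, he, c, hc, rfl⟩ := zero_or_isStandardSum hP hy
    · exact ⟨0, zero_mem _, (smul_zero _).trans h'.symm⟩
    have hval : ∀ a, (e a : ℤ) = γ a + d a := fun a => congrFun he a
    -- The inequality is strict because `γ a ≥ 1`; this is why `e - d` keeps the support of `e` and
    -- the same tops `y` remain admissible.
    have hlt : ∀ a, d a ≠ 0 → d a < e a := fun a ha => by
      have h1 := hγ a ha
      have h2 := hval a
      omega
    have hle : d ≤ e := fun a => by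
      by_cases ha : d a = 0
      · rw [ha]; exact Nat.zero_le _
      · exact (hlt a ha).le
    have hsupp : ∀ w, HasSupport e w → HasSupport (e - d) w := by
      intro w hw a
      rw [← hw a, Finsupp.tsub_apply]
      by_cases ha : d a = 0
      · rw [ha, tsub_zero]
      · have := hlt a ha
        omega
    have hstd : IsStandardSum (e - d) (∑ᶠ y, standardMonomial (e - d) y (c y)) :=
      ⟨c, fun y hy => hsupp y (hc y hy), rfl⟩
    have hdeg : expDegree (e - d) = γ := by
      funext a
      have h1 := hval a
      have h2 := hle a
      rw [expDegree, Finsupp.tsub_apply]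
      omega
    refine ⟨_, hdeg ▸ hstd.mem_faceRingPiece, ?_⟩
    change algebraMap (VertexRing k P) (FaceRing k P) (monomial d 1) * _ = _
    have := Fintype.ofFinite P
    rw [finsum_eq_sum_of_fintype, finsum_eq_sum_of_fintype, Finset.mul_sum]
    refine Finset.sum_congr rfl fun y _ => ?_
    by_cases hy : c y = 0
    · rw [hy, standardMonomial_zero, standardMonomial_zero, mul_zero]
    · rw [standardMonomial, standardMonomial, ← mul_assoc, ← map_mul,
        MvPolynomial.monomial_mul, one_mul]
      have hs := (hsupp y (hc y hy)).suppExp_le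
      have : d + (e - d - suppExp y) = e - suppExp y := by
        rw [← add_tsub_assoc_of_le hs, add_tsub_cancel_of_le hle]
      rw [this]

end FaceRingGrading
end

theorem corollary4p2 {k : Type u} [Field k] {P : Type v} [PartialOrder P] [OrderBot P] [Finite P]
    (hP : IsSimplicialPoset P) (ℓ : ℕ) (hℓ : 0 < ℓ) (α : PosetVertex P → ℤ)
    (hα : ∀ x, 1 - (ℓ : ℤ) ≤ α x) (i : ℕ) :
    ∃ e : extPiece i
          (ModuleCat.of (VertexRing k P) (VertexRing k P ⧸ powerIdeal k (PosetVertex P) ℓ))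
          (ModuleCat.of (VertexRing k P) (FaceRing k P))
          (quotientPiece (powerIdeal k (PosetVertex P) ℓ)) (faceRingPiece k P) α ≃ₗ[k]
        localCohomologyPiece (irrelevantIdeal k (PosetVertex P)) i
          (ModuleCat.of (VertexRing k P) (FaceRing k P)) (faceRingPiece k P) α,
      ∀ x, (e x).1 =
        (canonicalMapPower ℓ i (ModuleCat.of (VertexRing k P) (FaceRing k P))).hom x.1 := by
  classical
  exact exists_equiv_localCohomologyPiece (isSquarefree_faceRing hP) hα
    (Nat.find_spec (exists_irrelevantIdeal_pow_le (k := k) (σ := PosetVertex P) ℓ))
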